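/- Let $\mathbb{k}$ be $\mathbb{R}$ or $\mathbb{C}$. All Lie superalgebras, subalgebras, ideals and isomorphisms below are $\mathbb{Z}$-graded, the parity of a homogeneous element being its degree modulo $2$. **Semilocal algebras.** Let $\mathfrak g$ be a Lie algebra over $\mathbb{k}$ and $V$ a $\mathfrak g$-module, with representation map $\rho:\mathfrak g\to\mathrm{End}\,V$. Write $V[-1]$ for $V$ placed in degree $1$. Put $\mathbb U_1=V[-1]$, $\mathbb U_0=\mathfrak g$ and $\mathbb U_{-k-1}=\mathrm{Hom}(\mathbb U_1,\mathbb U_{-k})$ for $k\ge 0$, with the Lie bracket of $\mathfrak g$ on $\mathbb U_0$ and the brackets determined recursively by $$[x,u]=x(u),\qquad [u,x]=-(-1)^{x}x(u),\qquad [x,y](u)=[x,y(u)]+(-1)^{y}[x(u),y]$$ for homogeneous $x,y$ of degree $\le 0$ and $u\in\mathbb U_1$, where $x(u)=x\cdot u$ for $x\in\mathfrak g$. Let $\mathbb U=\mathbb U(\mathfrak g,V)$ be the unique Lie superalgebra extending these brackets whose positive part is freely generated by $\mathbb U_1$. For $\mathfrak g=\mathfrak{gl}(V)$ acting naturally on $V$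 this is the universal Lie superalgebra $U$ associated to $U_1=V[-1]$, with $U_0=\mathrm{End}\,V$ and $U_{-1}=\mathrm{Hom}(V[-1],\mathrm{End}\,V[-1])$. **The algebra $P$.** For a subspace $T_{-1}\subseteq U_{-1}$ let $\tilde P$ be the subalgebra of $U$ generated by $U_1$ and $T_{-1}$, and let $P(V[-1],T_{-1})$ be the quotient of $\tilde P$ by its maximal ideal intersecting $\tilde P_{-1}\oplus\tilde P_0\oplus\tilde P_1$ trivially (the sum of all such ideals). **The algebra $L$.** A Lie–Leibniz triple $(\mathfrak g,V,\Theta)$ consists of $\mathfrak g$ and $V$ as above and a linear map $\Theta:V\to\mathfrak g$ with $\Theta(\Theta(u)\cdot v)=[\Theta(u),\Theta(v)]$ for all $u,v\in V$. Consider $\Theta$ as an element of $\mathbb U_{-1}$, let $R_\Theta\subseteq\mathbb U_{-1}=\mathrm{Hom}(V,\mathfrak g)$ be the cyclic $\mathfrak g$-submodule generated by $\Theta$, and let $\tilde{\mathbb T}$ be the subalgebra of $\mathbb U$ generated by $R_\Theta$, $\mathbb U_0$ and $\mathbb U_1$. Put $\{u,v\}=\tfrac12\big(\Theta(u)\cdot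 v+\Theta(v)\cdot u\big)$, and let $K\subseteq\mathbb U_2$ be the sum of all $\mathfrak g$-submodules of $\mathbb U_2$ included in the subspace $\big\{\sum_i[u_i,v_i] : u_i,v_i\in V[-1],\ \sum_i\{u_i,v_i\}=0\big\}$. Let $\mathbb T$ be the quotient of $\tilde{\mathbb T}$ by the ideal generated by $K$, and let $L(\mathfrak g,V,\Theta)$ be the quotient of $\mathbb T$ by its maximal ideal concentrated in degrees $\ge 3$ (the sum of all such ideals). **Theorem.** Let $(\mathfrak g,V,\Theta)$ be a Lie–Leibniz triple with $\mathfrak g$ simple, $V$ faithful (that is, $\rho$ injective) and $\Theta\ne 0$. Then there is a subspace $T_{-1}$ of $\mathrm{Hom}(V[-1],\mathrm{End}\,V[-1])$ such that the Lie superalgebras $L(\mathfrak g,V,\Theta)$ and $P(V[-1],T_{-1})$ are isomorphic. -/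

import Mathlib

namespace TensorHierarchy

noncomputable section

/-! ### Graded vector spaces -/

section Graded

variable {𝕜 : Type*} [Field 𝕜] {G : Type*} [AddCommGroup G] [Module 𝕜 G]

/-- The linear projection of a `ℤ`-graded vector space `G = ⨁ deg k` onto its degree `k` part. -/
def gproj {deg : ℤ → Submodule 𝕜 G} (h : DirectSum.IsInternal deg) (k : ℤ) : G →ₗ[𝕜] G :=
  letI := h.chooseDecomposition
  (deg k).subtype ∘ₗ DirectSum.component 𝕜 ℤ (fun i => deg i) k ∘ₗ
    (DirectSum.decomposeLinearEquiv deg).toLinearMap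

theorem gproj_mem {deg : ℤ → Submodule 𝕜 G} (h : DirectSum.IsInternal deg) (k : ℤ) (x : G) :
    gproj h k x ∈ deg k := by
  simp [gproj]

theorem gproj_same {deg : ℤ → Submodule 𝕜 G} (h : DirectSum.IsInternal deg) {k : ℤ} {x : G}
    (hx : x ∈ deg k) : gproj h k x = x := by
  let _ := h.chooseDecomposition
  exact DirectSum.decompose_of_mem_same deg hx

theorem gproj_ne {deg : ℤ → Submodule 𝕜 G} (h : DirectSum.IsInternal deg) {j k : ℤ} (hjk : j ≠ k)
    {x : G} (hx : x ∈ deg j) : gproj h k x = 0 := by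
  let _ := h.chooseDecomposition
  exact DirectSum.decompose_of_mem_ne deg hx hjk

theorem mem_iSup_gproj {deg : ℤ → Submodule 𝕜 G} (h : DirectSum.IsInternal deg) (x : G) :
    x ∈ Submodule.span 𝕜 (Set.range fun k => gproj h k x) := by
  classical
  let _ := h.chooseDecomposition
  have := DirectSum.sum_support_decompose deg x
  have h2 : ∑ k ∈ (DirectSum.decompose deg x).support, (DirectSum.decompose deg x k : G) ∈
      Submodule.span 𝕜 (Set.range fun k => gproj h k x) :=
    Submodule.sum_mem _ fun k _ => Submodule.subset_span ⟨k, rfl⟩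
  rwa [this] at h2

theorem isInternal_of_proj (deg : ℤ → Submodule 𝕜 G) (π : ℤ → G →ₗ[𝕜] G)
    (same : ∀ k, ∀ x ∈ deg k, π k x = x) (ne : ∀ j k, j ≠ k → ∀ x ∈ deg j, π k x = 0)
    (top : ∀ x, x ∈ ⨆ k, deg k) : DirectSum.IsInternal deg := by
  rw [DirectSum.isInternal_submodule_iff_iSupIndep_and_iSup_eq_top]
  refine ⟨fun k => ?_, eq_top_iff.2 fun x _ => top x⟩
  rw [Submodule.disjoint_def]
  intro x hx hx'
  have : (⨆ j, ⨆ (_ : j ≠ k), deg j) ≤ LinearMap.ker (π k) :=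
    iSup₂_le fun j hj y hy => ne j k hj y hy
  rw [← same k x hx]
  exact this hx'

@[elab_as_elim]
theorem homog_induction {deg : ℤ → Submodule 𝕜 G} (h : DirectSum.IsInternal deg)
    {p : G → Prop} (hom : ∀ k, ∀ x ∈ deg k, p x) (zero : p 0)
    (add : ∀ x y, p x → p y → p (x + y)) (x : G) : p x := by
  have hx : x ∈ ⨆ k, deg k := by
    rw [(DirectSum.isInternal_submodule_iff_iSupIndep_and_iSup_eq_top deg).1 h |>.2]
    trivial
  exact Submodule.iSup_induction deg (motive := p) hx hom zero add

theorem isInternal_quot {deg : ℤ → Submodule 𝕜 G} (h : DirectSum.IsInternal deg)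
    (I : Submodule 𝕜 G) (hI : ∀ k, ∀ x ∈ I, gproj h k x ∈ I) :
    DirectSum.IsInternal fun k => (deg k).map I.mkQ := by
  refine isInternal_of_proj _ (fun k => I.mapQ I (gproj h k) (hI k)) ?_ ?_ ?_
  · rintro k _ ⟨x, hx, rfl⟩
    simp [gproj_same h hx]
  · rintro j k hjk _ ⟨x, hx, rfl⟩
    simp [gproj_ne h hjk hx]
  · intro x
    obtain ⟨x, rfl⟩ := I.mkQ_surjective x
    refine homog_induction h (p := fun x => I.mkQ x ∈ ⨆ k, (deg k).map I.mkQ) ?_ ?_ ?_ x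
    · exact fun k x hx => Submodule.mem_iSup_of_mem k ⟨x, hx, rfl⟩
    · simp
    · intro x y hx hy
      rw [map_add]
      exact add_mem hx hy

/-- The bilinear product induced on a quotient by a two-sided ideal. -/
def quotBracket (I : Submodule 𝕜 G) (b : G →ₗ[𝕜] G →ₗ[𝕜] G) (hl : ∀ x, ∀ y ∈ I, b x y ∈ I)
    (hr : ∀ x, ∀ y ∈ I, b y x ∈ I) : (G ⧸ I) →ₗ[𝕜] (G ⧸ I) →ₗ[𝕜] (G ⧸ I) :=
  I.liftQ
    { toFun := fun x => I.mapQ I (b x) (hl x)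
      map_add' := fun x y => by ext; simp
      map_smul' := fun c x => by ext; simp }
    (fun y hy => by
      rw [LinearMap.mem_ker]
      ext x
      simpa using hr x y hy)

end Graded

/-! ### Lie superalgebras -/

/-- A `ℤ`-graded Lie superalgebra, with parity equal to the degree modulo `2`. The sign `(-1)^(ij)`
is `(i * j).negOnePow`. -/
class GradedLieSuperalgebra (𝕜 : Type*) (G : Type*) [Field 𝕜] [AddCommGroup G] [Module 𝕜 G] where
  /-- the superbracket -/
  bracket : G →ₗ[𝕜] G →ₗ[𝕜] G
  /-- the subspace of homogeneous elements of a given degree -/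
  degree : ℤ → Submodule 𝕜 G
  isInternal : DirectSum.IsInternal degree
  bracket_mem : ∀ {i j : ℤ} {x y : G}, x ∈ degree i → y ∈ degree j → bracket x y ∈ degree (i + j)
  antisymm : ∀ {i j : ℤ} {x y : G}, x ∈ degree i → y ∈ degree j →
    bracket x y + (i * j).negOnePow • bracket y x = 0
  jacobi : ∀ {i j : ℤ} {x y : G} (z : G), x ∈ degree i → y ∈ degree j →
    bracket x (bracket y z) - (i * j).negOnePow • bracket y (bracket x z) =
      bracket (bracket x y) z

/-- The superbracket of a Lie superalgebra. -/
abbrev br (𝕜 : Type*) {G : Type*} [Field 𝕜] [AddCommGroup G] [Module 𝕜 G]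
    [GradedLieSuperalgebra 𝕜 G] : G →ₗ[𝕜] G →ₗ[𝕜] G :=
  GradedLieSuperalgebra.bracket

/-- The subspace of elements of degree `k` of a Lie superalgebra. -/
abbrev deg (𝕜 : Type*) (G : Type*) [Field 𝕜] [AddCommGroup G] [Module 𝕜 G]
    [GradedLieSuperalgebra 𝕜 G] (k : ℤ) : Submodule 𝕜 G :=
  GradedLieSuperalgebra.degree k

/-- The projection of a Lie superalgebra onto its subspace of degree `k`. -/
abbrev proj (𝕜 : Type*) (G : Type*) [Field 𝕜] [AddCommGroup G] [Module 𝕜 G]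
    [GradedLieSuperalgebra 𝕜 G] (k : ℤ) : G →ₗ[𝕜] G :=
  gproj (GradedLieSuperalgebra.isInternal (𝕜 := 𝕜) (G := G)) k

/-- An isomorphism of (graded) Lie superalgebras. -/
structure GLSEquiv (𝕜 : Type*) (G H : Type*) [Field 𝕜] [AddCommGroup G] [Module 𝕜 G]
    [GradedLieSuperalgebra 𝕜 G] [AddCommGroup H] [Module 𝕜 H] [GradedLieSuperalgebra 𝕜 H]
    extends G ≃ₗ[𝕜] H where
  map_deg : ∀ (k : ℤ) (x : G), x ∈ deg 𝕜 G k ↔ toFun x ∈ deg 𝕜 H k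
  map_br : ∀ x y : G, toFun (br 𝕜 x y) = br 𝕜 (toFun x) (toFun y)

section Sub

variable (𝕜 : Type*) (G : Type*) [Field 𝕜] [AddCommGroup G] [Module 𝕜 G]
  [GradedLieSuperalgebra 𝕜 G]

/-- A (graded) subalgebra of a Lie superalgebra. -/
structure GSubalgebra extends Submodule 𝕜 G where
  homogeneous : ∀ k, ∀ x ∈ carrier, proj 𝕜 G k x ∈ carrier
  br_mem : ∀ x ∈ carrier, ∀ y ∈ carrier, br 𝕜 x y ∈ carrier

/-- A (graded) ideal of a Lie superalgebra. -/
structure GIdeal extends Submodule 𝕜 G where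
  homogeneous : ∀ k, ∀ x ∈ carrier, proj 𝕜 G k x ∈ carrier
  br_mem_left : ∀ x, ∀ y ∈ carrier, br 𝕜 x y ∈ carrier
  br_mem_right : ∀ x, ∀ y ∈ carrier, br 𝕜 y x ∈ carrier

/-- The local part: the sum of the subspaces of degree `-1`, `0` and `1`. -/
def localPart : Submodule 𝕜 G := deg 𝕜 G (-1) ⊔ deg 𝕜 G 0 ⊔ deg 𝕜 G 1

/-- The sum of the subspaces of degree at least `n`. -/
def degGE (n : ℤ) : Submodule 𝕜 G := ⨆ (k : ℤ) (_ : n ≤ k), deg 𝕜 G k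

variable {𝕜 G}

/-- The subalgebra generated by a set: the intersection of all subalgebras including it. -/
def GSubalgebra.closure (s : Set G) : GSubalgebra 𝕜 G where
  toSubmodule := ⨅ (H : GSubalgebra 𝕜 G) (_ : s ⊆ H.toSubmodule), H.toSubmodule
  homogeneous k x hx := by
    simp only [AddSubsemigroup.mem_carrier, AddSubmonoid.mem_toSubsemigroup,
      Submodule.mem_toAddSubmonoid, Submodule.mem_iInf] at hx ⊢
    exact fun H hH => H.homogeneous k x (hx H hH)
  br_mem x hx y hy := by
    simp only [AddSubsemigroup.mem_carrier, AddSubmonoid.mem_toSubsemigroup,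
      Submodule.mem_toAddSubmonoid, Submodule.mem_iInf] at hx hy ⊢
    exact fun H hH => H.br_mem x (hx H hH) y (hy H hH)

/-- The ideal generated by a set: the intersection of all ideals including it. -/
def GIdeal.closure (s : Set G) : GIdeal 𝕜 G where
  toSubmodule := ⨅ (I : GIdeal 𝕜 G) (_ : s ⊆ I.toSubmodule), I.toSubmodule
  homogeneous k x hx := by
    simp only [AddSubsemigroup.mem_carrier, AddSubmonoid.mem_toSubsemigroup,
      Submodule.mem_toAddSubmonoid, Submodule.mem_iInf] at hx ⊢
    exact fun H hH => H.homogeneous k x (hx H hH)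
  br_mem_left x y hy := by
    simp only [AddSubsemigroup.mem_carrier, AddSubmonoid.mem_toSubsemigroup,
      Submodule.mem_toAddSubmonoid, Submodule.mem_iInf] at hy ⊢
    exact fun H hH => H.br_mem_left x y (hy H hH)
  br_mem_right x y hy := by
    simp only [AddSubsemigroup.mem_carrier, AddSubmonoid.mem_toSubsemigroup,
      Submodule.mem_toAddSubmonoid, Submodule.mem_iInf] at hy ⊢
    exact fun H hH => H.br_mem_right x y (hy H hH)

/-- The sum of all ideals in a given set of ideals. -/
def GIdeal.sum (S : Set (GIdeal 𝕜 G)) : GIdeal 𝕜 G where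
  toSubmodule := ⨆ I ∈ S, GIdeal.toSubmodule I
  homogeneous k := by
    have : (⨆ I ∈ S, GIdeal.toSubmodule I) ≤
        (⨆ I ∈ S, GIdeal.toSubmodule I).comap (proj 𝕜 G k) :=
      iSup₂_le fun I hI x hx =>
        (le_iSup₂_of_le (f := fun I (_ : I ∈ S) => GIdeal.toSubmodule I) I hI le_rfl)
          (I.homogeneous k x hx)
    exact fun x hx => this hx
  br_mem_left z := by
    have : (⨆ I ∈ S, GIdeal.toSubmodule I) ≤
        (⨆ I ∈ S, GIdeal.toSubmodule I).comap (br 𝕜 z) :=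
      iSup₂_le fun I hI x hx =>
        (le_iSup₂_of_le (f := fun I (_ : I ∈ S) => GIdeal.toSubmodule I) I hI le_rfl)
          (I.br_mem_left z x hx)
    exact fun x hx => this hx
  br_mem_right z := by
    have : (⨆ I ∈ S, GIdeal.toSubmodule I) ≤
        (⨆ I ∈ S, GIdeal.toSubmodule I).comap ((br 𝕜).flip z) :=
      iSup₂_le fun I hI x hx =>
        (le_iSup₂_of_le (f := fun I (_ : I ∈ S) => GIdeal.toSubmodule I) I hI le_rfl)
          (I.br_mem_right z x hx)
    exact fun x hx => this hx

variable (𝕜 G) in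
/-- The maximal ideal concentrated in degrees at least `n` (the sum of all such ideals). -/
def maxIdealGE (n : ℤ) : GIdeal 𝕜 G :=
  GIdeal.sum {I | I.toSubmodule ≤ degGE 𝕜 G n}

variable (𝕜 G) in
/-- The maximal ideal intersecting the local part trivially (the sum of all such ideals). -/
def maxIdealLocal : GIdeal 𝕜 G :=
  GIdeal.sum {I | I.toSubmodule ⊓ localPart 𝕜 G = ⊥}

/-- A subalgebra is a Lie superalgebra. -/
instance GSubalgebra.instGLS (H : GSubalgebra 𝕜 G) :
    GradedLieSuperalgebra 𝕜 H.toSubmodule where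
  bracket := LinearMap.mk₂ 𝕜 (fun x y => ⟨br 𝕜 (x : G) (y : G), H.br_mem x x.2 y y.2⟩)
    (fun _ _ _ => Subtype.ext (by simp)) (fun _ _ _ => Subtype.ext (by simp))
    (fun _ _ _ => Subtype.ext (by simp)) (fun _ _ _ => Subtype.ext (by simp))
  degree k := (deg 𝕜 G k).comap H.toSubmodule.subtype
  isInternal := by
    refine isInternal_of_proj _
      (fun k => (proj 𝕜 G k).restrict (H.homogeneous k)) ?_ ?_ ?_
    · intro k x hx
      exact Subtype.ext (gproj_same (GradedLieSuperalgebra.isInternal (𝕜 := 𝕜) (G := G)) hx)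
    · intro j k hjk x hx
      exact Subtype.ext (gproj_ne (GradedLieSuperalgebra.isInternal (𝕜 := 𝕜) (G := G)) hjk hx)
    · intro x
      have hx := mem_iSup_gproj (GradedLieSuperalgebra.isInternal (𝕜 := 𝕜) (G := G)) (x : G)
      have hle : Submodule.span 𝕜 (Set.range fun k =>
          proj 𝕜 G k (x : G)) ≤
          (⨆ k, (deg 𝕜 G k).comap H.toSubmodule.subtype).map H.toSubmodule.subtype := by
        rw [Submodule.span_le]
        rintro _ ⟨k, rfl⟩
        refine ⟨⟨_, H.homogeneous k x x.2⟩, ?_, rfl⟩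
        refine Submodule.mem_iSup_of_mem k ?_
        exact gproj_mem (GradedLieSuperalgebra.isInternal (𝕜 := 𝕜) (G := G)) k x
      obtain ⟨y, hy, hyx⟩ := hle hx
      rwa [← Subtype.ext hyx]
  bracket_mem hx hy := GradedLieSuperalgebra.bracket_mem (𝕜 := 𝕜) (G := G) hx hy
  antisymm hx hy :=
    Subtype.ext (GradedLieSuperalgebra.antisymm (𝕜 := 𝕜) (G := G) hx hy)
  jacobi z hx hy :=
    Subtype.ext (GradedLieSuperalgebra.jacobi (𝕜 := 𝕜) (G := G) (z : G) hx hy)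

/-- The quotient of a Lie superalgebra by an ideal is a Lie superalgebra. -/
instance GIdeal.instGLS (I : GIdeal 𝕜 G) :
    GradedLieSuperalgebra 𝕜 (G ⧸ I.toSubmodule) where
  bracket := quotBracket I.toSubmodule (br 𝕜) I.br_mem_left I.br_mem_right
  degree k := (deg 𝕜 G k).map I.toSubmodule.mkQ
  isInternal := isInternal_quot GradedLieSuperalgebra.isInternal I.toSubmodule I.homogeneous
  bracket_mem := by
    rintro i j _ _ ⟨x, hx, rfl⟩ ⟨y, hy, rfl⟩
    exact ⟨_, GradedLieSuperalgebra.bracket_mem hx hy, rfl⟩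
  antisymm := by
    rintro i j _ _ ⟨x, hx, rfl⟩ ⟨y, hy, rfl⟩
    have h := congrArg I.toSubmodule.mkQ (GradedLieSuperalgebra.antisymm (𝕜 := 𝕜) hx hy)
    rw [Units.smul_def, map_add, map_zsmul, map_zero, ← Units.smul_def] at h
    exact h
  jacobi := by
    rintro i j _ _ z ⟨x, hx, rfl⟩ ⟨y, hy, rfl⟩
    obtain ⟨z, rfl⟩ := I.toSubmodule.mkQ_surjective z
    have h := congrArg I.toSubmodule.mkQ (GradedLieSuperalgebra.jacobi (𝕜 := 𝕜) z hx hy)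
    rw [Units.smul_def, map_sub, map_zsmul, ← Units.smul_def] at h
    exact h

end Sub

/-! ### The universal Lie superalgebra -/

section Universal

variable (𝕜 : Type*) (g : Type*) (V : Type*) [Field 𝕜] [LieRing g] [LieAlgebra 𝕜 g]
  [AddCommGroup V] [Module 𝕜 V]

/-- The subspace of degree `-k` of the semilocal Lie superalgebra associated to a Lie algebra `g`
and a `g`-module `V`: the `k`-linear maps from `V` to `g`. Recursively, it is `g` for `k = 0` and
`Hom(V, Neg k)` for `k + 1`, see `negZero` and `negSucc`. -/
abbrev Neg (k : ℕ) : Type _ := MultilinearMap 𝕜 (fun _ : Fin k => V) g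

/-- The subspace of degree `0` is `g`. -/
def negZero : g ≃ₗ[𝕜] Neg 𝕜 g V 0 :=
  MultilinearMap.constLinearEquivOfIsEmpty 𝕜 𝕜 (fun _ : Fin 0 => V) g

/-- The subspace of degree `-(k+1)` is the space of linear maps from `V` to the subspace of
degree `-k`. -/
def negSucc (k : ℕ) : Neg 𝕜 g V (k + 1) ≃ₗ[𝕜] (V →ₗ[𝕜] Neg 𝕜 g V k) :=
  multilinearCurryLeftEquiv 𝕜 (fun _ : Fin (k + 1) => V) g

/-- The identity map between two spaces `Neg k` and `Neg m` with `k = m`. -/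
def negCast {k m : ℕ} (h : k = m) : Neg 𝕜 g V k ≃ₗ[𝕜] Neg 𝕜 g V m :=
  h ▸ LinearEquiv.refl 𝕜 (Neg 𝕜 g V k)

variable {𝕜 g V} in
/-- The degree of a nonassociative monomial whose letters have degrees. -/
def wt {X : Type*} (d : X → ℤ) : FreeMagma X → ℤ
  | .of x => d x
  | .mul a b => wt d a + wt d b

/-- Generators: the homogeneous elements of the semilocal Lie superalgebra
`⋯ ⊕ Neg 2 ⊕ Neg 1 ⊕ Neg 0 ⊕ V`. -/
inductive Gen
  | pos (v : V)
  | neg (k : ℕ) (x : Neg 𝕜 g V k)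

variable {𝕜 g V} in
/-- `V` has degree `1` and `Neg k` has degree `-k`. -/
def Gen.degree : Gen 𝕜 g V → ℤ
  | .pos _ => 1
  | .neg k _ => -k

/-- The free nonassociative algebra on the generators. -/
abbrev Free : Type _ := FreeNonUnitalNonAssocAlgebra 𝕜 (Gen 𝕜 g V)

variable {𝕜 g V} in
/-- The letter `v`, for `v ∈ V`. -/
def fpos (v : V) : Free 𝕜 g V := FreeNonUnitalNonAssocAlgebra.of 𝕜 (Gen.pos v)

variable {𝕜 g V} in
/-- The letter `x`, for `x` of degree `-k`. -/
def fneg {k : ℕ} (x : Neg 𝕜 g V k) : Free 𝕜 g V :=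
  FreeNonUnitalNonAssocAlgebra.of 𝕜 (Gen.neg k x)

/-- The elements of degree `k`: the combinations of the monomials of degree `k`. -/
def freeDeg (k : ℤ) : Submodule 𝕜 (Free 𝕜 g V) :=
  Submodule.span 𝕜 {a | ∃ m, wt Gen.degree m = k ∧ a = MonoidAlgebra.single m 1}

theorem single_mem_freeDeg (m : FreeMagma (Gen 𝕜 g V)) (c : 𝕜) :
    MonoidAlgebra.single m c ∈ freeDeg 𝕜 g V (wt Gen.degree m) := by
  have : MonoidAlgebra.single m c = c • (MonoidAlgebra.single m 1 : Free 𝕜 g V) := by simp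
  rw [this]
  exact Submodule.smul_mem _ _ (Submodule.subset_span ⟨m, rfl, rfl⟩)

theorem freeDeg_internal : DirectSum.IsInternal (freeDeg 𝕜 g V) := by
  classical
  let e := MonoidAlgebra.coeffLinearEquiv (M := FreeMagma (Gen 𝕜 g V)) 𝕜 (S := 𝕜)
  refine isInternal_of_proj _ (fun k => e.symm.toLinearMap ∘ₗ
    (Finsupp.lsum 𝕜 fun m => if wt Gen.degree m = k then Finsupp.lsingle m else 0) ∘ₗ
      e.toLinearMap) ?_ ?_ ?_
  · intro k x hx
    induction hx using Submodule.span_induction with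
    | mem x h =>
      obtain ⟨m, hm, rfl⟩ := h
      simp [e, hm]
    | zero => simp
    | add x y _ _ hx hy => rw [map_add, hx, hy]
    | smul c x _ hx => rw [map_smul, hx]
  · intro j k hjk x hx
    induction hx using Submodule.span_induction with
    | mem x h =>
      obtain ⟨m, hm, rfl⟩ := h
      have : wt Gen.degree m ≠ k := hm ▸ hjk
      simp [e, this]
    | zero => simp
    | add x y _ _ hx hy => rw [map_add, hx, hy, add_zero]
    | smul c x _ hx => rw [map_smul, hx, smul_zero]
  · intro x
    induction x using MonoidAlgebra.induction_linear with
    | zero => exact zero_mem _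
    | add x y hx hy => exact add_mem hx hy
    | single m c => exact Submodule.mem_iSup_of_mem _ (single_mem_freeDeg 𝕜 g V m c)

theorem freeDeg_mul {i j : ℤ} {a b : Free 𝕜 g V} (ha : a ∈ freeDeg 𝕜 g V i)
    (hb : b ∈ freeDeg 𝕜 g V j) : a * b ∈ freeDeg 𝕜 g V (i + j) := by
  induction ha using Submodule.span_induction with
  | mem x h =>
    obtain ⟨m, rfl, rfl⟩ := h
    induction hb using Submodule.span_induction with
    | mem x h =>
      obtain ⟨n, rfl, rfl⟩ := h
      rw [MonoidAlgebra.single_mul_single]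
      exact single_mem_freeDeg 𝕜 g V (m * n) _
    | zero => simp
    | add x y _ _ hx hy => rw [mul_add]; exact add_mem hx hy
    | smul c x _ hx => rw [mul_smul_comm]; exact Submodule.smul_mem _ _ hx
  | zero => simp
  | add x y _ _ hx hy => rw [add_mul]; exact add_mem hx hy
  | smul c x _ hx => rw [smul_mul_assoc]; exact Submodule.smul_mem _ _ hx

theorem fpos_mem (v : V) : (fpos v : Free 𝕜 g V) ∈ freeDeg 𝕜 g V 1 :=
  single_mem_freeDeg 𝕜 g V (FreeMagma.of (Gen.pos v)) 1

theorem fneg_mem {k : ℕ} (x : Neg 𝕜 g V k) : fneg x ∈ freeDeg 𝕜 g V (-k) :=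
  single_mem_freeDeg 𝕜 g V (FreeMagma.of (Gen.neg k x)) 1

variable [LieRingModule g V] [LieModule 𝕜 g V]

/-- The superbracket `[x, y]` of an element `x` of degree `-j` and an element `y` of degree `-k`,
where `j + k = m`. It is the Lie bracket of `g` if `j = k = 0`, and otherwise it is defined
recursively by `[x, y](u) = [x, y(u)] + (-1)^k [x(u), y]` for `u ∈ V`, where `x(u) = x · u` for
`x ∈ g`, and where `[x, u] = x(u)` and `[u, y] = -(-1)^k y(u)`. -/
def negBr : (m j k : ℕ) → j + k = m → (Neg 𝕜 g V j →ₗ[𝕜] Neg 𝕜 g V k →ₗ[𝕜] Neg 𝕜 g V m)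
  | 0, 0, 0, _ =>
    LinearMap.mk₂ 𝕜
      (fun x y => negZero 𝕜 g V ⁅(negZero 𝕜 g V).symm x, (negZero 𝕜 g V).symm y⁆)
      (by intros; simp) (by intros; simp) (by intros; simp) (by intros; simp)
  | 0, j + 1, k, h => absurd h (by omega)
  | m + 1, 0, k + 1, h =>
    -- `[x, y](u) = [x, y(u)] - y(x · u)`
    LinearMap.mk₂ 𝕜
      (fun x y => (negSucc 𝕜 g V m).symm
        (negBr m 0 k (by omega) x ∘ₗ negSucc 𝕜 g V k y -
          (negCast 𝕜 g V (by omega)).toLinearMap ∘ₗ negSucc 𝕜 g V k y ∘ₗ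
            LieModule.toEnd 𝕜 g V ((negZero 𝕜 g V).symm x)))
      (by intros; apply (negSucc 𝕜 g V m).injective; ext1; simp; abel)
      (by intros; apply (negSucc 𝕜 g V m).injective; ext1; simp [smul_sub])
      (by intros; apply (negSucc 𝕜 g V m).injective; ext1; simp; abel)
      (by intros; apply (negSucc 𝕜 g V m).injective; ext1; simp [smul_sub])
  | m + 1, j + 1, 0, h =>
    -- `[x, y](u) = x(y · u) + [x(u), y]`
    LinearMap.mk₂ 𝕜
      (fun x y => (negSucc 𝕜 g V m).symm
        ((negCast 𝕜 g V (by omega)).toLinearMap ∘ₗ negSucc 𝕜 g V j x ∘ₗ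
            LieModule.toEnd 𝕜 g V ((negZero 𝕜 g V).symm y) +
          (negBr m j 0 (by omega)).flip y ∘ₗ negSucc 𝕜 g V j x))
      (by intros; apply (negSucc 𝕜 g V m).injective; ext1; simp; abel)
      (by intros; apply (negSucc 𝕜 g V m).injective; ext1; simp)
      (by intros; apply (negSucc 𝕜 g V m).injective; ext1; simp; abel)
      (by intros; apply (negSucc 𝕜 g V m).injective; ext1; simp)
  | m + 1, j + 1, k + 1, h =>
    -- `[x, y](u) = [x, y(u)] + (-1)^(k+1) [x(u), y]`
    LinearMap.mk₂ 𝕜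
      (fun x y => (negSucc 𝕜 g V m).symm
        (negBr m (j + 1) k (by omega) x ∘ₗ negSucc 𝕜 g V k y +
          (-1 : 𝕜) ^ (k + 1) • ((negBr m j (k + 1) (by omega)).flip y ∘ₗ negSucc 𝕜 g V j x)))
      (by intros; apply (negSucc 𝕜 g V m).injective; ext1; simp; abel)
      (by intros; apply (negSucc 𝕜 g V m).injective; ext1; simp [smul_smul, mul_comm])
      (by intros; apply (negSucc 𝕜 g V m).injective; ext1; simp; abel)
      (by intros; apply (negSucc 𝕜 g V m).injective; ext1; simp [smul_smul, mul_comm])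

variable {𝕜 g V} in
/-- The defining relations of the universal Lie superalgebra. -/
inductive Rel : Free 𝕜 g V → Prop
  | pos_add (u v : V) : Rel (fpos (u + v) - (fpos u + fpos v))
  | pos_smul (c : 𝕜) (v : V) : Rel (fpos (c • v) - c • fpos v)
  | neg_add {k : ℕ} (x y : Neg 𝕜 g V k) : Rel (fneg (x + y) - (fneg x + fneg y))
  | neg_smul {k : ℕ} (c : 𝕜) (x : Neg 𝕜 g V k) : Rel (fneg (c • x) - c • fneg x)
  /- the superbracket of the semilocal Lie superalgebra -/
  | zero_pos (x : Neg 𝕜 g V 0) (v : V) :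
      Rel (fneg x * fpos v - fpos ⁅(negZero 𝕜 g V).symm x, v⁆)
  | succ_pos {k : ℕ} (x : Neg 𝕜 g V (k + 1)) (v : V) :
      Rel (fneg x * fpos v - fneg (negSucc 𝕜 g V k x v))
  | neg_neg {j k : ℕ} (x : Neg 𝕜 g V j) (y : Neg 𝕜 g V k) :
      Rel (fneg x * fneg y - fneg (negBr 𝕜 g V (j + k) j k rfl x y))
  /- the axioms of a Lie superalgebra -/
  | antisymm {i j : ℤ} {a b : Free 𝕜 g V} (ha : a ∈ freeDeg 𝕜 g V i) (hb : b ∈ freeDeg 𝕜 g V j) :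
      Rel (a * b + (i * j).negOnePow • (b * a))
  | jacobi {i j l : ℤ} {a b c : Free 𝕜 g V} (ha : a ∈ freeDeg 𝕜 g V i)
      (hb : b ∈ freeDeg 𝕜 g V j) (hc : c ∈ freeDeg 𝕜 g V l) :
      Rel (a * (b * c) - (i * j).negOnePow • (b * (a * c)) - a * b * c)

/-- The two-sided ideal generated by the defining relations. -/
def relIdeal : Submodule 𝕜 (Free 𝕜 g V) :=
  sInf {I | (∀ a, Rel a → a ∈ I) ∧ (∀ a, ∀ b ∈ I, a * b ∈ I) ∧ ∀ a, ∀ b ∈ I, b * a ∈ I}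

theorem rel_mem {a : Free 𝕜 g V} (h : Rel a) : a ∈ relIdeal 𝕜 g V :=
  (Submodule.mem_sInf).2 fun _ hI => hI.1 a h

theorem relIdeal_left (a b : Free 𝕜 g V) (hb : b ∈ relIdeal 𝕜 g V) : a * b ∈ relIdeal 𝕜 g V :=
  (Submodule.mem_sInf).2 fun I hI => hI.2.1 a b ((Submodule.mem_sInf).1 hb I hI)

theorem relIdeal_right (a b : Free 𝕜 g V) (hb : b ∈ relIdeal 𝕜 g V) : b * a ∈ relIdeal 𝕜 g V :=
  (Submodule.mem_sInf).2 fun I hI => hI.2.2 a b ((Submodule.mem_sInf).1 hb I hI)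

theorem rel_homogeneous {a : Free 𝕜 g V} (h : Rel a) : ∃ k, a ∈ freeDeg 𝕜 g V k := by
  have us : ∀ (n : ℤˣ) {k : ℤ} {x : Free 𝕜 g V}, x ∈ freeDeg 𝕜 g V k →
      n • x ∈ freeDeg 𝕜 g V k := by
    intro n k x hx
    rw [Units.smul_def]
    exact zsmul_mem hx _
  cases h with
  | pos_add u v => exact ⟨1, sub_mem (fpos_mem 𝕜 g V _) (add_mem (fpos_mem 𝕜 g V _) (fpos_mem 𝕜 g V _))⟩
  | pos_smul c v => exact ⟨1, sub_mem (fpos_mem 𝕜 g V _) (Submodule.smul_mem _ _ (fpos_mem 𝕜 g V _))⟩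
  | neg_add x y => exact ⟨_, sub_mem (fneg_mem 𝕜 g V _) (add_mem (fneg_mem 𝕜 g V _) (fneg_mem 𝕜 g V _))⟩
  | neg_smul c x => exact ⟨_, sub_mem (fneg_mem 𝕜 g V _) (Submodule.smul_mem _ _ (fneg_mem 𝕜 g V _))⟩
  | zero_pos x v =>
    refine ⟨1, sub_mem ?_ (fpos_mem 𝕜 g V _)⟩
    simpa using freeDeg_mul 𝕜 g V (fneg_mem 𝕜 g V x) (fpos_mem 𝕜 g V v)
  | @succ_pos k x v =>
    refine ⟨-k, sub_mem ?_ (fneg_mem 𝕜 g V _)⟩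
    simpa using freeDeg_mul 𝕜 g V (fneg_mem 𝕜 g V x) (fpos_mem 𝕜 g V v)
  | @neg_neg j k x y =>
    refine ⟨-(j + k : ℕ), sub_mem ?_ (fneg_mem 𝕜 g V _)⟩
    have := freeDeg_mul 𝕜 g V (fneg_mem 𝕜 g V x) (fneg_mem 𝕜 g V y)
    rwa [← _root_.neg_add, ← Nat.cast_add] at this
  | @antisymm i j a b ha hb =>
    refine ⟨i + j, add_mem (freeDeg_mul 𝕜 g V ha hb) (us _ ?_)⟩
    rw [add_comm]
    exact freeDeg_mul 𝕜 g V hb ha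
  | @jacobi i j l a b c ha hb hc =>
    refine ⟨i + j + l, sub_mem (sub_mem ?_ (us _ ?_)) ?_⟩
    · rw [add_assoc]
      exact freeDeg_mul 𝕜 g V ha (freeDeg_mul 𝕜 g V hb hc)
    · rw [add_comm i j, add_assoc]
      exact freeDeg_mul 𝕜 g V hb (freeDeg_mul 𝕜 g V ha hc)
    · exact freeDeg_mul 𝕜 g V (freeDeg_mul 𝕜 g V ha hb) hc

theorem jacobi_mem {i j : ℤ} {a b : Free 𝕜 g V} (ha : a ∈ freeDeg 𝕜 g V i)
    (hb : b ∈ freeDeg 𝕜 g V j) (c : Free 𝕜 g V) :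
    a * (b * c) - (i * j).negOnePow • (b * (a * c)) - a * b * c ∈ relIdeal 𝕜 g V := by
  refine homog_induction (freeDeg_internal 𝕜 g V) ?_ ?_ ?_ c
  · exact fun l c hc => rel_mem 𝕜 g V (Rel.jacobi ha hb hc)
  · simp
  · intro x y hx hy
    have h := add_mem hx hy
    convert h using 1
    simp only [mul_add, smul_add]
    abel

theorem relIdeal_homogeneous (k : ℤ) (x : Free 𝕜 g V) (hx : x ∈ relIdeal 𝕜 g V) :
    gproj (freeDeg_internal 𝕜 g V) k x ∈ relIdeal 𝕜 g V := by
  have hint := freeDeg_internal 𝕜 g V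
  have hl : ∀ (i k : ℤ) (a b : Free 𝕜 g V), a ∈ freeDeg 𝕜 g V i →
      gproj hint k (a * b) = a * gproj hint (k - i) b := by
    intro i k a b ha
    refine homog_induction hint ?_ (by simp) (fun x y hx hy => by
      rw [mul_add, map_add, hx, hy, map_add, mul_add]) b
    intro j b hb
    have hab := freeDeg_mul 𝕜 g V ha hb
    by_cases h : i + j = k
    · subst h
      rw [gproj_same hint hab, add_sub_cancel_left, gproj_same hint hb]
    · rw [gproj_ne hint h hab, gproj_ne hint (by omega) hb, mul_zero]
  have hr : ∀ (i k : ℤ) (a b : Free 𝕜 g V), a ∈ freeDeg 𝕜 g V i →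
      gproj hint k (b * a) = gproj hint (k - i) b * a := by
    intro i k a b ha
    refine homog_induction hint ?_ (by simp) (fun x y hx hy => by
      rw [add_mul, map_add, hx, hy, map_add, add_mul]) b
    intro j b hb
    have hab := freeDeg_mul 𝕜 g V hb ha
    by_cases h : j + i = k
    · subst h
      rw [gproj_same hint hab, add_sub_cancel_right, gproj_same hint hb]
    · rw [gproj_ne hint h hab, gproj_ne hint (by omega) hb, zero_mul]
  have key : relIdeal 𝕜 g V ≤ ⨅ k, (relIdeal 𝕜 g V).comap (gproj hint k) := by
    refine sInf_le ⟨?_, ?_, ?_⟩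
    · intro a ha
      rw [Submodule.mem_iInf]
      intro k
      obtain ⟨j, hj⟩ := rel_homogeneous 𝕜 g V ha
      rw [Submodule.mem_comap]
      by_cases h : j = k
      · subst h
        rw [gproj_same hint hj]
        exact rel_mem 𝕜 g V ha
      · rw [gproj_ne hint h hj]
        exact zero_mem _
    · intro a b hb
      rw [Submodule.mem_iInf] at hb ⊢
      intro k
      rw [Submodule.mem_comap]
      refine homog_induction hint ?_ (by simp) (fun x y hx hy => by
        rw [add_mul, map_add]; exact add_mem hx hy) a
      intro i a ha
      rw [hl i k a b ha]
      exact relIdeal_left 𝕜 g V _ _ (hb (k - i))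
    · intro a b hb
      rw [Submodule.mem_iInf] at hb ⊢
      intro k
      rw [Submodule.mem_comap]
      refine homog_induction hint ?_ (by simp) (fun x y hx hy => by
        rw [mul_add, map_add]; exact add_mem hx hy) a
      intro i a ha
      rw [hr i k a b ha]
      exact relIdeal_right 𝕜 g V _ _ (hb (k - i))
  exact (Submodule.mem_iInf _).1 (key hx) k

/-- The Lie superalgebra `⋯ ⊕ Hom(V, g) ⊕ g ⊕ V ⊕ ⋯` associated to a Lie algebra `g` and a
`g`-module `V` placed in degree `1`: the extension of the semilocal Lie superalgebra
`⋯ ⊕ Hom(V, Hom(V, g)) ⊕ Hom(V, g) ⊕ g ⊕ V` whose positive part is freely generated by `V`.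
It is presented as the Lie superalgebra generated by the semilocal vector space, with the brackets
of the semilocal Lie superalgebra as the only relations (so that there are no relations among the
elements of `V`). -/
def FreeExt : Type _ := Free 𝕜 g V ⧸ relIdeal 𝕜 g V

instance : AddCommGroup (FreeExt 𝕜 g V) :=
  inferInstanceAs (AddCommGroup (Free 𝕜 g V ⧸ relIdeal 𝕜 g V))

instance : Module 𝕜 (FreeExt 𝕜 g V) :=
  inferInstanceAs (Module 𝕜 (Free 𝕜 g V ⧸ relIdeal 𝕜 g V))

/-- The projection from the free nonassociative algebra. -/
def FreeExt.mk : Free 𝕜 g V →ₗ[𝕜] FreeExt 𝕜 g V := (relIdeal 𝕜 g V).mkQ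

instance : GradedLieSuperalgebra 𝕜 (FreeExt 𝕜 g V) where
  bracket := quotBracket (relIdeal 𝕜 g V) (LinearMap.mul 𝕜 (Free 𝕜 g V))
    (relIdeal_left 𝕜 g V) (relIdeal_right 𝕜 g V)
  degree k := (freeDeg 𝕜 g V k).map (FreeExt.mk 𝕜 g V)
  isInternal := isInternal_quot (freeDeg_internal 𝕜 g V) (relIdeal 𝕜 g V)
    (relIdeal_homogeneous 𝕜 g V)
  bracket_mem := by
    rintro i j _ _ ⟨x, hx, rfl⟩ ⟨y, hy, rfl⟩
    exact ⟨_, freeDeg_mul 𝕜 g V hx hy, rfl⟩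
  antisymm := by
    rintro i j _ _ ⟨x, hx, rfl⟩ ⟨y, hy, rfl⟩
    have h := (Submodule.Quotient.mk_eq_zero _).2 (rel_mem 𝕜 g V (Rel.antisymm hx hy))
    exact h
  jacobi := by
    rintro i j _ _ z ⟨x, hx, rfl⟩ ⟨y, hy, rfl⟩
    obtain ⟨z, rfl⟩ := (relIdeal 𝕜 g V).mkQ_surjective z
    have h := (Submodule.Quotient.mk_eq_zero _).2 (jacobi_mem 𝕜 g V hx hy z)
    exact sub_eq_zero.1 h

/-- The inclusion of `V` in degree `1`. -/
def FreeExt.pos : V →ₗ[𝕜] FreeExt 𝕜 g V where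
  toFun v := FreeExt.mk 𝕜 g V (fpos v)
  map_add' u v := by
    have h := (Submodule.Quotient.mk_eq_zero _).2 (rel_mem 𝕜 g V (Rel.pos_add u v))
    exact sub_eq_zero.1 h
  map_smul' c v := by
    have h := (Submodule.Quotient.mk_eq_zero _).2 (rel_mem 𝕜 g V (Rel.pos_smul c v))
    exact sub_eq_zero.1 h

/-- The inclusion of `Neg k` in degree `-k`. -/
def FreeExt.neg (k : ℕ) : Neg 𝕜 g V k →ₗ[𝕜] FreeExt 𝕜 g V where
  toFun x := FreeExt.mk 𝕜 g V (fneg x)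
  map_add' x y := by
    have h := (Submodule.Quotient.mk_eq_zero _).2 (rel_mem 𝕜 g V (Rel.neg_add x y))
    exact sub_eq_zero.1 h
  map_smul' c x := by
    have h := (Submodule.Quotient.mk_eq_zero _).2 (rel_mem 𝕜 g V (Rel.neg_smul c x))
    exact sub_eq_zero.1 h

/-- The inclusion of `g` in degree `0`. -/
def FreeExt.zero : g →ₗ[𝕜] FreeExt 𝕜 g V := FreeExt.neg 𝕜 g V 0 ∘ₗ (negZero 𝕜 g V).toLinearMap

/-- The inclusion of `Hom(V, g)` in degree `-1`. -/
def FreeExt.hom : (V →ₗ[𝕜] g) →ₗ[𝕜] FreeExt 𝕜 g V :=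
  FreeExt.neg 𝕜 g V 1 ∘ₗ (negSucc 𝕜 g V 0).symm.toLinearMap ∘ₗ
    LinearMap.compRight 𝕜 (negZero 𝕜 g V).toLinearMap

end Universal

/-! ### The Lie superalgebra `P(V[-1], T)` -/

section Minimal

variable {𝕜 : Type*} {V : Type*} [Field 𝕜] [AddCommGroup V] [Module 𝕜 V]

/- `End V` is a Lie algebra with the commutator as Lie bracket, and `V` is an `End V`-module with
`⁅f, v⁆ = f v`. -/
attribute [local instance] LieRing.ofAssociativeRing

variable (𝕜 V) in
/-- The universal Lie superalgebra associated to the vector space `V` placed in degree `1`, with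
`End V` in degree `0` and `Hom(V, End V)` in degree `-1`. -/
abbrev Kantor : Type _ := FreeExt 𝕜 (Module.End 𝕜 V) V

/-- The subalgebra of the universal Lie superalgebra generated by `V` (in degree `1`) and by a
subspace `T` of `Hom(V, End V)` (in degree `-1`). -/
def PTilde (T : Submodule 𝕜 (V →ₗ[𝕜] Module.End 𝕜 V)) : GSubalgebra 𝕜 (Kantor 𝕜 V) :=
  GSubalgebra.closure
    (Set.range (FreeExt.pos 𝕜 (Module.End 𝕜 V) V) ∪ FreeExt.hom 𝕜 (Module.End 𝕜 V) V '' T)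

/-- The Lie superalgebra `P(V[-1], T)`: the quotient of `PTilde T` by its maximal ideal
intersecting the local part trivially. -/
abbrev P (T : Submodule 𝕜 (V →ₗ[𝕜] Module.End 𝕜 V)) : Type _ :=
  (PTilde T).toSubmodule ⧸ (maxIdealLocal 𝕜 (PTilde T).toSubmodule).toSubmodule

end Minimal

/-! ### The Lie superalgebra `L(g, V, Θ)` -/

section Triple

variable {𝕜 : Type*} {g : Type*} {V : Type*} [Field 𝕜] [LieRing g] [LieAlgebra 𝕜 g]
  [AddCommGroup V] [Module 𝕜 V] [LieRingModule g V] [LieModule 𝕜 g V]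

/-- `(g, V, Θ)` is a Lie–Leibniz triple: `Θ` satisfies the quadratic constraint. -/
def IsLieLeibnizTriple (Θ : V →ₗ[𝕜] g) : Prop :=
  ∀ u v : V, Θ ⁅Θ u, v⁆ = ⁅Θ u, Θ v⁆

/-- The cyclic `g`-submodule of `Hom(V, g)` generated by `Θ`. -/
def cyclic (Θ : V →ₗ[𝕜] g) : LieSubmodule 𝕜 g (V →ₗ[𝕜] g) :=
  LieSubmodule.lieSpan 𝕜 g {Θ}

/-- The subalgebra of `FreeExt 𝕜 g V` generated by the cyclic submodule of `Hom(V, g)` generated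
by `Θ` (in degree `-1`), by `g` (in degree `0`) and by `V` (in degree `1`). -/
def TTilde (Θ : V →ₗ[𝕜] g) : GSubalgebra 𝕜 (FreeExt 𝕜 g V) :=
  GSubalgebra.closure
    (FreeExt.hom 𝕜 g V '' cyclic Θ ∪ Set.range (FreeExt.zero 𝕜 g V) ∪
      Set.range (FreeExt.pos 𝕜 g V))

/-- The symmetric part `{u, v} = (u • v + v • u) / 2` of the Leibniz product `u • v = Θ(u) · v`. -/
def symProd (Θ : V →ₗ[𝕜] g) : V →ₗ[𝕜] V →ₗ[𝕜] V :=
  LinearMap.mk₂ 𝕜 (fun u v => (2⁻¹ : 𝕜) • (⁅Θ u, v⁆ + ⁅Θ v, u⁆))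
    (by intros; simp; module) (by intros; simp; module)
    (by intros; simp; module) (by intros; simp; module)

/-- The kernel of the map `{·,·}`, considered as a subspace of the degree `2` part of
`FreeExt 𝕜 g V`: the set of all elements `∑ [uᵢ, vᵢ]` such that `∑ {uᵢ, vᵢ} = 0`. -/
def symKer (Θ : V →ₗ[𝕜] g) : Submodule 𝕜 (FreeExt 𝕜 g V) :=
  (LinearMap.ker (TensorProduct.lift (symProd Θ))).map
    (TensorProduct.lift
      ((br 𝕜 (G := FreeExt 𝕜 g V)).compl₁₂ (FreeExt.pos 𝕜 g V) (FreeExt.pos 𝕜 g V)))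

/-- The sum `K` of all `g`-submodules of the degree `2` part which are included in the kernel of
`{·,·}`, where `g` acts by the bracket. -/
def kerModule (Θ : V →ₗ[𝕜] g) : Submodule 𝕜 (FreeExt 𝕜 g V) :=
  sSup {W | (∀ x : g, ∀ w ∈ W, br 𝕜 (FreeExt.zero 𝕜 g V x) w ∈ W) ∧ W ≤ symKer Θ}

/-- The ideal of `TTilde Θ` generated by `K`. -/
def kerIdeal (Θ : V →ₗ[𝕜] g) : GIdeal 𝕜 (TTilde Θ).toSubmodule :=
  GIdeal.closure {k | (k : FreeExt 𝕜 g V) ∈ kerModule Θ}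

/-- The Lie superalgebra `𝕋` canonically associated to `(g, V, Θ)`. -/
abbrev TAlg (Θ : V →ₗ[𝕜] g) : Type _ :=
  (TTilde Θ).toSubmodule ⧸ (kerIdeal Θ).toSubmodule

/-- The Lie superalgebra `L(g, V, Θ)`: the quotient of `𝕋` by its maximal ideal concentrated in
degrees at least `3`. -/
abbrev L (Θ : V →ₗ[𝕜] g) : Type _ :=
  TAlg Θ ⧸ (maxIdealGE 𝕜 (TAlg Θ) 3).toSubmodule

end Triple

end

end TensorHierarchy

namespace TensorHierarchy

noncomputable section

/-! Take for $T_{-1}$ the image of $R_\Theta$ under $\varphi \mapsto \rho\circ\varphi$. The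
representation $\rho$ induces a homomorphism from $\mathbb U(\mathfrak g,V)$ to $U$. It restricts to
a surjection $f$ from $\tilde{\mathbb T}$ onto $\tilde P$ (`exists_TTilde_PTilde`). That
$\rho(\mathfrak g)$ lies in $\tilde P$ uses simplicity: the values of the maps in $R_\Theta$ span a
nonzero ideal, so all of $\mathfrak g$ is spanned by brackets $[\varphi,v]=\varphi(v)$
(`span_cyclic_apply`). Faithfulness makes $f$ injective in degrees at most $1$.

Hence $L$ and $P$ are both quotients of $\tilde{\mathbb T}$, and it remains to compare the two
kernels. The bridge is the identity $[\Theta,[u,v]]=2\{u,v\}$ (`br_hom_brTensor`). In one direction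
it shows that $R_\Theta$ annihilates $K$ (`br_hom_kerModule`), so the ideal generated by $K$ lives
in degrees at least $2$ (`proj_eq_zero_of_mem_kerIdeal`). The kernel of the map to $L$ therefore has
no component in degrees at most $1$, and its image under $f$ is an ideal missing the local part.

In the other direction, let $J$ be an ideal of $\tilde{\mathbb T}$ missing the local part. It
vanishes in negative degrees, where elements are detected by their brackets with $V$
(`GIdeal.eq_zero_of_mem_deg_neg`). Its part $J_2$ is a $\mathfrak g$-module which $\Theta$ maps into
$J_1=0$, so $J_2\subseteq K$ (`GIdeal.mem_kerIdeal_of_mem_deg_two`). Modulo $K$, only degrees at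
least $3$ survive.

All this requires that the presented algebra be known in degrees at most $1$: the generators do not
collapse (`FreeExt.pos_injective`, `FreeExt.neg_injective`, from an action on the tensor algebra of
$V$), and there is nothing else in those degrees (`mem_generatorSpan`). -/

theorem units_smul_mem {𝕜 G : Type*} [Field 𝕜] [AddCommGroup G] [Module 𝕜 G]
    (W : Submodule 𝕜 G) (n : ℤˣ) {x : G} (hx : x ∈ W) : n • x ∈ W := by
  rw [Units.smul_def]
  exact zsmul_mem hx _

/-! ### Homogeneous components, generated subalgebras and sums of ideals. -/

section GradedLemmas

variable {𝕜 : Type*} {G : Type*} [Field 𝕜] [AddCommGroup G] [Module 𝕜 G]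
  [GradedLieSuperalgebra 𝕜 G]

theorem proj_mem (k : ℤ) (x : G) : proj 𝕜 G k x ∈ deg 𝕜 G k := gproj_mem _ k x

theorem proj_same {k : ℤ} {x : G} (hx : x ∈ deg 𝕜 G k) : proj 𝕜 G k x = x := gproj_same _ hx

theorem proj_ne {j k : ℤ} (hjk : j ≠ k) {x : G} (hx : x ∈ deg 𝕜 G j) : proj 𝕜 G k x = 0 :=
  gproj_ne _ hjk hx

@[elab_as_elim]
theorem deg_induction {p : G → Prop} (hom : ∀ k, ∀ x ∈ deg 𝕜 G k, p x) (zero : p 0)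
    (add : ∀ x y, p x → p y → p (x + y)) (x : G) : p x :=
  homog_induction (GradedLieSuperalgebra.isInternal (𝕜 := 𝕜) (G := G)) hom zero add x

theorem mem_span_proj (x : G) :
    x ∈ Submodule.span 𝕜 (Set.range fun k => proj 𝕜 G k x) :=
  mem_iSup_gproj _ x

theorem mem_of_proj_mem {W : Submodule 𝕜 G} {x : G} (h : ∀ k, proj 𝕜 G k x ∈ W) : x ∈ W := by
  refine (Submodule.span_le.2 ?_) (mem_span_proj (𝕜 := 𝕜) x)
  rintro _ ⟨k, rfl⟩
  exact h k

theorem eq_zero_of_proj {x : G} (h : ∀ k, proj 𝕜 G k x = 0) : x = 0 :=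
  (Submodule.mem_bot 𝕜).1 (mem_of_proj_mem fun k => (Submodule.mem_bot 𝕜).2 (h k))

theorem proj_mem_of_mem {W : Submodule 𝕜 G} {j : ℤ} {x : G} (hd : x ∈ deg 𝕜 G j) (hx : x ∈ W)
    (k : ℤ) : proj 𝕜 G k x ∈ W := by
  by_cases h : j = k
  · subst h
    rwa [proj_same hd]
  · rw [proj_ne h hd]
    exact zero_mem _

theorem br_comm {i j : ℤ} {x y : G} (hx : x ∈ deg 𝕜 G i) (hy : y ∈ deg 𝕜 G j) :
    br 𝕜 x y = -((i * j).negOnePow • br 𝕜 y x) :=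
  eq_neg_of_add_eq_zero_left (GradedLieSuperalgebra.antisymm hx hy)

theorem br_br {i j : ℤ} {x y : G} (z : G) (hx : x ∈ deg 𝕜 G i) (hy : y ∈ deg 𝕜 G j) :
    br 𝕜 x (br 𝕜 y z) = br 𝕜 (br 𝕜 x y) z + (i * j).negOnePow • br 𝕜 y (br 𝕜 x z) :=
  sub_eq_iff_eq_add.1 (GradedLieSuperalgebra.jacobi z hx hy)

theorem br_deg {i j : ℤ} {x y : G} (hx : x ∈ deg 𝕜 G i) (hy : y ∈ deg 𝕜 G j) :
    br 𝕜 x y ∈ deg 𝕜 G (i + j) :=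
  GradedLieSuperalgebra.bracket_mem hx hy

theorem br_mem_swap {W : Submodule 𝕜 G} {i j : ℤ} {x y : G} (hx : x ∈ deg 𝕜 G i)
    (hy : y ∈ deg 𝕜 G j) (h : br 𝕜 x y ∈ W) : br 𝕜 y x ∈ W := by
  rw [br_comm hy hx]
  exact neg_mem (units_smul_mem W _ h)

/-- A subspace closed under brackets of its homogeneous elements includes the subalgebra generated
by any set of homogeneous elements which it includes. -/
theorem GSubalgebra.closure_le {s : Set G} (W : Submodule 𝕜 G)
    (hs : ∀ x ∈ s, ∃ k, x ∈ deg 𝕜 G k) (hsW : s ⊆ W)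
    (hbr : ∀ i j, ∀ x ∈ W, ∀ y ∈ W, x ∈ deg 𝕜 G i → y ∈ deg 𝕜 G j → br 𝕜 x y ∈ W) :
    (GSubalgebra.closure (𝕜 := 𝕜) s).toSubmodule ≤ W := by
  -- `W` need not be graded, so it is replaced by its largest graded subspace: the elements all of
  -- whose components lie in `W`. This one is a graded subalgebra.
  let W' : Submodule 𝕜 G := ⨅ k, W.comap (proj 𝕜 G k)
  have mem' : ∀ x, x ∈ W' ↔ ∀ k, proj 𝕜 G k x ∈ W := fun x => by simp [W']
  let H : GSubalgebra 𝕜 G :=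
    { W' with
      homogeneous := fun k x hx => (mem' _).2 fun j =>
        proj_mem_of_mem (proj_mem k x) ((mem' x).1 hx k) j
      br_mem := fun x hx y hy => by
        refine (mem' _).2 fun k => ?_
        have key : br 𝕜 x y ∈ W.comap (proj 𝕜 G k) := by
          have h1 : x ∈ (W.comap (proj 𝕜 G k)).comap ((br 𝕜).flip y) := by
            refine mem_of_proj_mem fun i => ?_
            change y ∈ (W.comap (proj 𝕜 G k)).comap (br 𝕜 (proj 𝕜 G i x))
            refine mem_of_proj_mem fun j => ?_
            exact proj_mem_of_mem (br_deg (proj_mem i x) (proj_mem j y))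
              (hbr i j _ ((mem' x).1 hx i) _ ((mem' y).1 hy j) (proj_mem i x) (proj_mem j y)) k
          exact h1
        exact key }
  intro x hx
  refine mem_of_proj_mem ((mem' x).1 ?_)
  simp only [GSubalgebra.closure, Submodule.mem_iInf] at hx
  refine hx H fun y hy => (mem' y).2 fun k => ?_
  obtain ⟨j, hj⟩ := hs y hy
  exact proj_mem_of_mem hj (hsW hy) k

theorem GSubalgebra.subset_closure (s : Set G) :
    s ⊆ (GSubalgebra.closure (𝕜 := 𝕜) s).toSubmodule := fun x hx => by
  simp only [GSubalgebra.closure, SetLike.mem_coe, Submodule.mem_iInf]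
  exact fun H hH => hH hx

theorem GIdeal.subset_closure (s : Set G) :
    s ⊆ (GIdeal.closure (𝕜 := 𝕜) s).toSubmodule := fun x hx => by
  simp only [GIdeal.closure, SetLike.mem_coe, Submodule.mem_iInf]
  exact fun H hH => hH hx

theorem GIdeal.closure_le {s : Set G} {I : GIdeal 𝕜 G} (h : s ⊆ I.toSubmodule) :
    (GIdeal.closure (𝕜 := 𝕜) s).toSubmodule ≤ I.toSubmodule :=
  iInf₂_le I h

theorem GIdeal.le_sum {S : Set (GIdeal 𝕜 G)} {I : GIdeal 𝕜 G} (h : I ∈ S) :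
    I.toSubmodule ≤ (GIdeal.sum S).toSubmodule :=
  le_iSup₂_of_le (f := fun I (_ : I ∈ S) => GIdeal.toSubmodule I) I h le_rfl

theorem GIdeal.sum_le {S : Set (GIdeal 𝕜 G)} {W : Submodule 𝕜 G}
    (h : ∀ I ∈ S, I.toSubmodule ≤ W) : (GIdeal.sum S).toSubmodule ≤ W :=
  iSup₂_le h

theorem mem_degGE_iff {n : ℤ} {x : G} : x ∈ degGE 𝕜 G n ↔ ∀ k < n, proj 𝕜 G k x = 0 := by
  constructor
  · intro hx k hk
    have : degGE 𝕜 G n ≤ LinearMap.ker (proj 𝕜 G k) :=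
      iSup₂_le fun j hj y hy => proj_ne (by omega) hy
    exact this hx
  · intro h
    refine mem_of_proj_mem fun k => ?_
    by_cases hk : k < n
    · rw [h k hk]
      exact zero_mem _
    · exact (le_iSup₂_of_le (f := fun k (_ : n ≤ k) => deg 𝕜 G k) k (by omega) le_rfl)
        (proj_mem k x)

/-- Since the ideal is graded, it contains the components of its elements. The right-hand side is a
linear condition on elements, hence stable under sums of ideals, images and preimages in a way the
intersection is not visibly. -/
theorem GIdeal.inf_localPart_eq_bot_iff (I : GIdeal 𝕜 G) :
    I.toSubmodule ⊓ localPart 𝕜 G = ⊥ ↔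
      ∀ k : ℤ, -1 ≤ k → k ≤ 1 → ∀ x ∈ I.toSubmodule, proj 𝕜 G k x = 0 := by
  constructor
  · intro h k hk hk' x hx
    have h1 : proj 𝕜 G k x ∈ I.toSubmodule ⊓ localPart 𝕜 G := by
      refine ⟨I.homogeneous k x hx, ?_⟩
      have h2 := proj_mem (𝕜 := 𝕜) k x
      obtain rfl | rfl | rfl : k = -1 ∨ k = 0 ∨ k = 1 := by omega
      · exact Submodule.mem_sup_left (Submodule.mem_sup_left h2)
      · exact Submodule.mem_sup_left (Submodule.mem_sup_right h2)
      · exact Submodule.mem_sup_right h2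
    rw [h] at h1
    exact (Submodule.mem_bot 𝕜).1 h1
  · intro h
    rw [eq_bot_iff]
    rintro x ⟨hx, hx'⟩
    refine (Submodule.mem_bot 𝕜).2 (eq_zero_of_proj (𝕜 := 𝕜) fun k => ?_)
    by_cases hk : -1 ≤ k ∧ k ≤ 1
    · exact h k hk.1 hk.2 x hx
    · have : localPart 𝕜 G ≤ LinearMap.ker (proj 𝕜 G k) :=
        sup_le (sup_le (fun y hy => proj_ne (by omega) hy) fun y hy => proj_ne (by omega) hy)
          fun y hy => proj_ne (by omega) hy
      exact this hx'

/-- Vanishing of a component defines a subspace, the kernel of the projection; it includes each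
ideal in the sum, hence the sum itself. -/
theorem proj_eq_zero_of_mem_maxIdealLocal {k : ℤ} (hk : -1 ≤ k) (hk' : k ≤ 1) {x : G}
    (hx : x ∈ (maxIdealLocal 𝕜 G).toSubmodule) : proj 𝕜 G k x = 0 := by
  have : (maxIdealLocal 𝕜 G).toSubmodule ≤ LinearMap.ker (proj 𝕜 G k) :=
    GIdeal.sum_le fun I hI x hx => (I.inf_localPart_eq_bot_iff.1 hI) k hk hk' x hx
  exact this hx

end GradedLemmas

/-! ### Homomorphisms, images and preimages of ideals, and isomorphism from equal kernels. -/

section Hom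

variable (𝕜 : Type*) (G H : Type*) [Field 𝕜] [AddCommGroup G] [Module 𝕜 G]
  [GradedLieSuperalgebra 𝕜 G] [AddCommGroup H] [Module 𝕜 H] [GradedLieSuperalgebra 𝕜 H]

/-- A homomorphism of (graded) Lie superalgebras. -/
structure GLSHom extends G →ₗ[𝕜] H where
  map_deg : ∀ (k : ℤ) (x : G), x ∈ deg 𝕜 G k → toFun x ∈ deg 𝕜 H k
  map_br : ∀ x y : G, toFun (br 𝕜 x y) = br 𝕜 (toFun x) (toFun y)

variable {𝕜 G H}

theorem GLSHom.apply_mem (f : GLSHom 𝕜 G H) {k : ℤ} {x : G} (hx : x ∈ deg 𝕜 G k) :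
    f.toLinearMap x ∈ deg 𝕜 H k :=
  f.map_deg k x hx

theorem GLSHom.apply_br (f : GLSHom 𝕜 G H) (x y : G) :
    f.toLinearMap (br 𝕜 x y) = br 𝕜 (f.toLinearMap x) (f.toLinearMap y) :=
  f.map_br x y

theorem GLSHom.map_proj (f : GLSHom 𝕜 G H) (k : ℤ) (x : G) :
    f.toLinearMap (proj 𝕜 G k x) = proj 𝕜 H k (f.toLinearMap x) := by
  refine deg_induction (𝕜 := 𝕜) ?_ ?_ ?_ x
  rotate_left
  · simp only [map_zero]
  · intro x y hx hy
    simp only [map_add, hx, hy]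
  intro j x hx
  by_cases h : j = k
  · subst h
    rw [proj_same hx, proj_same (f.apply_mem hx)]
  · rw [proj_ne h hx, map_zero, proj_ne h (f.apply_mem hx)]

/-- The projection on the quotient by an ideal. -/
noncomputable def GIdeal.toQuot (I : GIdeal 𝕜 G) : GLSHom 𝕜 G (G ⧸ I.toSubmodule) where
  toLinearMap := I.toSubmodule.mkQ
  map_deg _ x hx := ⟨x, hx, rfl⟩
  map_br _ _ := rfl

theorem GIdeal.toQuot_surjective (I : GIdeal 𝕜 G) : Function.Surjective I.toQuot.toLinearMap :=
  I.toSubmodule.mkQ_surjective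

theorem GIdeal.toQuot_eq_zero (I : GIdeal 𝕜 G) {x : G} :
    I.toQuot.toLinearMap x = 0 ↔ x ∈ I.toSubmodule :=
  Submodule.Quotient.mk_eq_zero _

/-- The composition of two homomorphisms. -/
def GLSHom.comp {K : Type*} [AddCommGroup K] [Module 𝕜 K] [GradedLieSuperalgebra 𝕜 K]
    (e : GLSHom 𝕜 H K) (f : GLSHom 𝕜 G H) : GLSHom 𝕜 G K where
  toLinearMap := e.toLinearMap ∘ₗ f.toLinearMap
  map_deg k x hx := e.map_deg k _ (f.map_deg k x hx)
  map_br x y := (congrArg e.toLinearMap (f.map_br x y)).trans (e.map_br _ _)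

/-- The preimage of an ideal. -/
def GIdeal.comap (f : GLSHom 𝕜 G H) (I : GIdeal 𝕜 H) : GIdeal 𝕜 G where
  toSubmodule := I.toSubmodule.comap f.toLinearMap
  homogeneous k x hx := by
    change f.toLinearMap _ ∈ I.toSubmodule
    rw [f.map_proj]
    exact I.homogeneous k _ hx
  br_mem_left x y hy := by
    change f.toLinearMap _ ∈ I.toSubmodule
    rw [f.apply_br]
    exact I.br_mem_left _ _ hy
  br_mem_right x y hy := by
    change f.toLinearMap _ ∈ I.toSubmodule
    rw [f.apply_br]
    exact I.br_mem_right _ _ hy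

/-- The image of an ideal under a surjective homomorphism. -/
def GIdeal.map (f : GLSHom 𝕜 G H) (hf : Function.Surjective f.toLinearMap) (I : GIdeal 𝕜 G) :
    GIdeal 𝕜 H where
  toSubmodule := I.toSubmodule.map f.toLinearMap
  homogeneous k := by
    rintro _ ⟨x, hx, rfl⟩
    exact ⟨_, I.homogeneous k x hx, f.map_proj k x⟩
  br_mem_left y := by
    rintro _ ⟨x, hx, rfl⟩
    obtain ⟨y, rfl⟩ := hf y
    exact ⟨_, I.br_mem_left y x hx, f.map_br y x⟩
  br_mem_right y := by
    rintro _ ⟨x, hx, rfl⟩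
    obtain ⟨y, rfl⟩ := hf y
    exact ⟨_, I.br_mem_right y x hx, f.map_br x y⟩

/-- Two surjective homomorphisms with the same kernel have isomorphic images. -/
theorem GLSEquiv.nonempty_of_ker_eq {K : Type*} [AddCommGroup K] [Module 𝕜 K]
    [GradedLieSuperalgebra 𝕜 K] (p : GLSHom 𝕜 G H) (q : GLSHom 𝕜 G K)
    (hp : Function.Surjective p.toLinearMap) (hq : Function.Surjective q.toLinearMap)
    (h : ∀ x, p.toLinearMap x = 0 ↔ q.toLinearMap x = 0) : Nonempty (GLSEquiv 𝕜 H K) := by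
  let e : H ≃ₗ[𝕜] K := (p.toLinearMap.quotKerEquivOfSurjective hp).symm ≪≫ₗ
    Submodule.quotEquivOfEq _ _ (by ext x; exact h x) ≪≫ₗ
      q.toLinearMap.quotKerEquivOfSurjective hq
  have he : ∀ x, e (p.toLinearMap x) = q.toLinearMap x := fun x => by
    have : (p.toLinearMap.quotKerEquivOfSurjective hp).symm (p.toLinearMap x) =
        Submodule.Quotient.mk x := by
      rw [LinearEquiv.symm_apply_eq]
      rfl
    simp only [e, LinearEquiv.trans_apply, this]
    rfl
  refine ⟨{ e with map_deg := ?_, map_br := ?_ }⟩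
  · intro k y
    obtain ⟨x, rfl⟩ := hp y
    change _ ↔ e _ ∈ _
    rw [he]
    constructor
    · intro hy
      -- Kernels of graded maps are graded: if `p x` has degree `k`, the other components of `x` die
      -- under `p`, hence under `q`, so `q x` is the image of the degree `k` component.
      have : p.toLinearMap (x - proj 𝕜 G k x) = 0 := by
        rw [map_sub, p.map_proj, proj_same hy, sub_self]
      rw [h, map_sub, sub_eq_zero] at this
      rw [this]
      exact q.map_deg k _ (proj_mem k x)
    · intro hy
      have : q.toLinearMap (x - proj 𝕜 G k x) = 0 := by
        rw [map_sub, q.map_proj, proj_same hy, sub_self]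
      rw [← h, map_sub, sub_eq_zero] at this
      rw [this]
      exact p.map_deg k _ (proj_mem k x)
  · intro y y'
    obtain ⟨x, rfl⟩ := hp y
    obtain ⟨x', rfl⟩ := hp y'
    change e _ = br 𝕜 (e _) (e _)
    rw [he, he]
    exact (congrArg e (p.map_br x x').symm).trans ((he _).trans (q.map_br x x'))

end Hom

theorem map_units_smul {𝕜 G H : Type*} [Field 𝕜] [AddCommGroup G] [Module 𝕜 G] [AddCommGroup H]
    [Module 𝕜 H] (f : G →ₗ[𝕜] H) (n : ℤˣ) (x : G) : f (n • x) = n • f x := by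
  rw [Units.smul_def, Units.smul_def, map_zsmul]

/-! ### Universal property of the presented Lie superalgebra. -/

section Lift

variable {𝕜 : Type*} {g : Type*} {V : Type*} [Field 𝕜] [LieRing g] [LieAlgebra 𝕜 g]
  [AddCommGroup V] [Module 𝕜 V]

theorem Free.exists_lift {H : Type*} [AddCommGroup H] [Module 𝕜 H] (b : H →ₗ[𝕜] H →ₗ[𝕜] H)
    (f : Gen 𝕜 g V → H) : ∃ φ : Free 𝕜 g V →ₗ[𝕜] H,
      (∀ x, φ (FreeNonUnitalNonAssocAlgebra.of 𝕜 x) = f x) ∧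
        ∀ x y, φ (x * y) = b (φ x) (φ y) := by
  -- The bilinear map `b` is installed as a multiplication on `H`, so that the universal property of
  -- the free nonassociative algebra applies.
  let _ : NonUnitalNonAssocSemiring H :=
    { (inferInstance : AddCommMonoid H) with
      mul := fun x y => b x y
      left_distrib := fun x y z => map_add (b x) y z
      right_distrib := fun x y z => by
        change b (x + y) z = b x z + b y z
        simp
      zero_mul := fun x => by
        change b 0 x = 0
        simp
      mul_zero := fun x => map_zero (b x) }
  have : IsScalarTower 𝕜 H H := ⟨fun c x y => by
    change b (c • x) y = c • b x y
    simp⟩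
  have : SMulCommClass 𝕜 H H := ⟨fun c x y => by
    change c • b x y = b x (c • y)
    simp⟩
  let F := FreeNonUnitalNonAssocAlgebra.lift 𝕜 f
  exact ⟨(F : Free 𝕜 g V →ₗ[𝕜] H), fun x => FreeNonUnitalNonAssocAlgebra.lift_of_apply 𝕜 f x,
    fun x y => map_mul F x y⟩

@[elab_as_elim]
theorem Free.induction {p : FreeMagma (Gen 𝕜 g V) → Free 𝕜 g V → Prop}
    (of : ∀ x, p (.of x) (FreeNonUnitalNonAssocAlgebra.of 𝕜 x))
    (mul : ∀ m n x y, p m x → p n y → p (m * n) (x * y)) (m : FreeMagma (Gen 𝕜 g V)) :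
    p m (MonoidAlgebra.single m 1) := by
  induction m with
  | ih1 x => exact of x
  | ih2 m n hm hn =>
    have := mul _ _ _ _ hm hn
    rwa [MonoidAlgebra.single_mul_single, mul_one] at this

variable [LieRingModule g V] [LieModule 𝕜 g V]

/-- The universal property of the presented Lie superalgebra. -/
theorem FreeExt.exists_lift {H : Type*} [AddCommGroup H] [Module 𝕜 H] (b : H →ₗ[𝕜] H →ₗ[𝕜] H)
    (D : ℤ → Submodule 𝕜 H)
    (hb : ∀ i j, ∀ x ∈ D i, ∀ y ∈ D j, b x y ∈ D (i + j))
    (anti : ∀ i j, ∀ x ∈ D i, ∀ y ∈ D j, b x y + (i * j).negOnePow • b y x = 0)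
    (jac : ∀ i j l, ∀ x ∈ D i, ∀ y ∈ D j, ∀ z ∈ D l,
      b x (b y z) - (i * j).negOnePow • b y (b x z) = b (b x y) z)
    (p : V →ₗ[𝕜] H) (n : ∀ k, Neg 𝕜 g V k →ₗ[𝕜] H)
    (hp : ∀ v, p v ∈ D 1) (hn : ∀ (k : ℕ) x, n k x ∈ D (-k))
    (zero_pos : ∀ x v, b (n 0 x) (p v) = p ⁅(negZero 𝕜 g V).symm x, v⁆)
    (succ_pos : ∀ k x v, b (n (k + 1) x) (p v) = n k (negSucc 𝕜 g V k x v))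
    (neg_neg : ∀ j k x y, b (n j x) (n k y) = n (j + k) (negBr 𝕜 g V (j + k) j k rfl x y)) :
    ∃ Φ : FreeExt 𝕜 g V →ₗ[𝕜] H, (∀ v, Φ (FreeExt.pos 𝕜 g V v) = p v) ∧
      (∀ k x, Φ (FreeExt.neg 𝕜 g V k x) = n k x) ∧
      (∀ x y, Φ (br 𝕜 x y) = b (Φ x) (Φ y)) ∧
      ∀ k, ∀ x ∈ deg 𝕜 (FreeExt 𝕜 g V) k, Φ x ∈ D k := by
  let f : Gen 𝕜 g V → H := fun x => match x with
    | .pos v => p v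
    | .neg k x => n k x
  obtain ⟨φ, hφ, hmul⟩ := Free.exists_lift b f
  have hpos : ∀ v, φ (fpos v) = p v := fun v => hφ _
  have hneg : ∀ {k} (x : Neg 𝕜 g V k), φ (fneg x) = n k x := fun x => hφ _
  have hdeg : ∀ k, ∀ x ∈ freeDeg 𝕜 g V k, φ x ∈ D k := by
    intro k
    refine Submodule.span_le (p := (D k).comap φ).2 ?_
    rintro _ ⟨m, rfl, rfl⟩
    refine Free.induction (p := fun m x => φ x ∈ D (wt Gen.degree m)) ?_ ?_ m
    · intro x
      rw [hφ]
      cases x with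
      | pos v => exact hp v
      | neg k x => exact hn k x
    · intro m n x y hx hy
      rw [hmul]
      exact hb _ _ _ hx _ hy
  have hrel : relIdeal 𝕜 g V ≤ LinearMap.ker φ := by
    refine sInf_le ⟨?_, ?_, ?_⟩
    · intro a ha
      rw [LinearMap.mem_ker]
      cases ha with
      | pos_add u v => simp [hpos]
      | pos_smul c v => simp [hpos]
      | neg_add x y => simp [hneg]
      | neg_smul c x => simp [hneg]
      | zero_pos x v => rw [map_sub, hmul, hneg, hpos, hpos, zero_pos, sub_self]
      | succ_pos x v => rw [map_sub, hmul, hneg, hpos, hneg, succ_pos, sub_self]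
      | neg_neg x y => rw [map_sub, hmul, hneg, hneg, hneg, neg_neg, sub_self]
      | antisymm ha hb =>
        rw [map_add, map_units_smul, hmul, hmul]
        exact anti _ _ _ (hdeg _ _ ha) _ (hdeg _ _ hb)
      | jacobi ha hb hc =>
        simp only [map_sub, map_units_smul, hmul]
        exact sub_eq_zero.2 (jac _ _ _ _ (hdeg _ _ ha) _ (hdeg _ _ hb) _ (hdeg _ _ hc))
    · intro a b hb
      rw [LinearMap.mem_ker] at hb ⊢
      rw [hmul, hb, map_zero]
    · intro a b hb
      rw [LinearMap.mem_ker] at hb ⊢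
      rw [hmul, hb, map_zero, LinearMap.zero_apply]
  refine ⟨(relIdeal 𝕜 g V).liftQ φ hrel, hpos, fun k x => hneg x, ?_, ?_⟩
  · intro x y
    obtain ⟨x, rfl⟩ := (relIdeal 𝕜 g V).mkQ_surjective x
    obtain ⟨y, rfl⟩ := (relIdeal 𝕜 g V).mkQ_surjective y
    exact hmul x y
  · rintro k _ ⟨x, hx, rfl⟩
    exact hdeg k x hx

end Lift

/-! ### Supercommutators of operators without a grading on the module. -/

section SuperCommutator

variable {𝕜 : Type*} {A : Type*} [Field 𝕜] [Ring A] [Algebra 𝕜 A]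

variable (𝕜 A) in
/-- The supercommutator of the superalgebra `A ⊕ A ε`, where `ε` is odd with `ε ^ 2 = 1` and
commutes with the even algebra `A`. -/
def superComm : (A × A) →ₗ[𝕜] (A × A) →ₗ[𝕜] (A × A) :=
  LinearMap.mk₂ 𝕜
    (fun x y => (x.1 * y.1 - y.1 * x.1 + x.2 * y.2 + y.2 * x.2,
      x.1 * y.2 - y.2 * x.1 + x.2 * y.1 - y.1 * x.2))
    (by intros; ext <;> simp [add_mul, mul_add] <;> abel)
    (by intros; ext <;> simp [smul_sub, smul_add])
    (by intros; ext <;> simp [add_mul, mul_add] <;> abel)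
    (by intros; ext <;> simp [smul_sub, smul_add])

variable (𝕜 A) in
open Classical in
/-- The inclusion of `A` in the part of `A ⊕ A ε` with the parity of `k`. -/
def parityIncl (k : ℤ) : A →ₗ[𝕜] (A × A) :=
  if Even k then LinearMap.inl 𝕜 A A else LinearMap.inr 𝕜 A A

theorem superComm_parityIncl (i j : ℤ) (a b : A) :
    superComm 𝕜 A (parityIncl 𝕜 A i a) (parityIncl 𝕜 A j b) =
      parityIncl 𝕜 A (i + j) (a * b - (i * j).negOnePow • (b * a)) := by
  by_cases hi : Even i <;> by_cases hj : Even j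
  · have : (i * j).negOnePow = 1 := Int.negOnePow_even _ (hi.mul_right _)
    simp [parityIncl, superComm, hi, hj, Int.even_add, this]
  · have : (i * j).negOnePow = 1 := Int.negOnePow_even _ (hi.mul_right _)
    simp [parityIncl, superComm, hi, hj, Int.even_add, this]
  · have : (i * j).negOnePow = 1 := Int.negOnePow_even _ (hj.mul_left _)
    simp [parityIncl, superComm, hi, hj, Int.even_add, this]
  · have : (i * j).negOnePow = -1 :=
      Int.negOnePow_odd _ ((Int.not_even_iff_odd.1 hi).mul (Int.not_even_iff_odd.1 hj))
    simp [parityIncl, superComm, hi, hj, Int.even_add, this]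

theorem parityIncl_injective (k : ℤ) : Function.Injective (parityIncl 𝕜 A k) := by
  unfold parityIncl
  split_ifs
  · exact LinearMap.inl_injective
  · exact LinearMap.inr_injective

theorem superComm_antisymm (i j : ℤ) (a b : A) :
    superComm 𝕜 A (parityIncl 𝕜 A i a) (parityIncl 𝕜 A j b) +
      (i * j).negOnePow • superComm 𝕜 A (parityIncl 𝕜 A j b) (parityIncl 𝕜 A i a) = 0 := by
  rw [superComm_parityIncl, superComm_parityIncl, add_comm j i, ← map_units_smul, ← map_add,
    mul_comm j i]
  obtain h | h := Int.units_eq_one_or (i * j).negOnePow <;> simp [h]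

theorem superComm_jacobi (i j l : ℤ) (a b c : A) :
    superComm 𝕜 A (parityIncl 𝕜 A i a)
        (superComm 𝕜 A (parityIncl 𝕜 A j b) (parityIncl 𝕜 A l c)) -
      (i * j).negOnePow • superComm 𝕜 A (parityIncl 𝕜 A j b)
        (superComm 𝕜 A (parityIncl 𝕜 A i a) (parityIncl 𝕜 A l c)) =
      superComm 𝕜 A (superComm 𝕜 A (parityIncl 𝕜 A i a) (parityIncl 𝕜 A j b))
        (parityIncl 𝕜 A l c) := by
  simp only [superComm_parityIncl]
  rw [add_left_comm j i l, add_assoc, ← map_units_smul, ← map_sub]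
  congr 1
  rw [mul_add, mul_add, add_mul, mul_comm j i]
  simp only [Int.negOnePow_add]
  -- After expansion the identity depends on the degrees only through the three pairwise signs; for
  -- each choice it is an identity in an associative ring.
  obtain h | h := Int.units_eq_one_or (i * j).negOnePow <;>
  obtain h' | h' := Int.units_eq_one_or (i * l).negOnePow <;>
  obtain h'' | h'' := Int.units_eq_one_or (j * l).negOnePow <;>
  simp only [h, h', h'', Units.smul_def] <;> simp <;> noncomm_ring

end SuperCommutator

/-! ### An induced module on the tensor algebra of `V`. -/

section Model

variable {𝕜 : Type*} {g : Type*} {V : Type*} [Field 𝕜] [LieRing g] [LieAlgebra 𝕜 g]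
  [AddCommGroup V] [Module 𝕜 V] {ι : Type*} (B : Module.Basis ι 𝕜 V)

/-- Left multiplication by vectors on the tensor algebra of `V`, with words in a basis of `V` as
a basis of the tensor algebra. -/
def consOp : V →ₗ[𝕜] Module.End 𝕜 (List ι →₀ 𝕜) :=
  B.constr 𝕜 fun b => Finsupp.lmapDomain 𝕜 𝕜 (List.cons b)

theorem consOp_basis (b : ι) (l : List ι) (c : 𝕜) :
    consOp B (B b) (Finsupp.single l c) = Finsupp.single (b :: l) c := by
  simp [consOp]

theorem negCast_rfl (k : ℕ) (x : Neg 𝕜 g V k) : negCast 𝕜 g V (rfl : k = k) x = x := rfl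

variable [LieRingModule g V] [LieModule 𝕜 g V]

/-- The action of elements of nonpositive degree on words, in the module induced from the trivial
module over the nonpositive part. -/
def wordOp : List ι → (k : ℕ) → Neg 𝕜 g V k →ₗ[𝕜] (List ι →₀ 𝕜)
  | [], _ => 0
  | b :: l, 0 =>
    (consOp B).flip (Finsupp.single l 1) ∘ₗ (LieModule.toEnd 𝕜 g V : g →ₗ[𝕜] Module.End 𝕜 V).flip (B b) ∘ₗ
      (negZero 𝕜 g V).symm.toLinearMap + consOp B (B b) ∘ₗ wordOp l 0
  | b :: l, k + 1 =>
    wordOp l k ∘ₗ LinearMap.applyₗ (B b) ∘ₗ (negSucc 𝕜 g V k).toLinearMap +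
      (-1 : 𝕜) ^ (k + 1) • (consOp B (B b) ∘ₗ wordOp l (k + 1))

/-- The action of elements of nonpositive degree on the module induced from the trivial module
over the nonpositive part. -/
def negOp (k : ℕ) : Neg 𝕜 g V k →ₗ[𝕜] Module.End 𝕜 (List ι →₀ 𝕜) where
  toFun x := Finsupp.linearCombination 𝕜 fun l => wordOp B l k x
  map_add' x y := by ext; simp
  map_smul' c x := by ext; simp

theorem negOp_single (k : ℕ) (x : Neg 𝕜 g V k) (l : List ι) :
    negOp B k x (Finsupp.single l 1) = wordOp B l k x := by
  simp [negOp]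

/-- This and `negOp_succ_consOp` are the rule $x(vw)=[x,v]\,w\pm v\,(xw)$ of an induced module. The
recursion defining `wordOp` imposes it for basis vectors and words; both sides being bilinear in `v`
and `w`, it holds in general. -/
theorem negOp_zero_consOp (x : Neg 𝕜 g V 0) (v : V) (w : List ι →₀ 𝕜) :
    negOp B 0 x (consOp B v w) =
      consOp B ⁅(negZero 𝕜 g V).symm x, v⁆ w + consOp B v (negOp B 0 x w) := by
  have : (consOp B).compr₂ (negOp B 0 x) =
      consOp B ∘ₗ LieModule.toEnd 𝕜 g V ((negZero 𝕜 g V).symm x) +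
        (consOp B).compl₂ (negOp B 0 x) := by
    refine B.ext fun b => ?_
    ext l : 2
    simp [consOp_basis, negOp_single, wordOp]
  exact LinearMap.congr_fun₂ this v w

theorem negOp_succ_consOp (k : ℕ) (x : Neg 𝕜 g V (k + 1)) (v : V) (w : List ι →₀ 𝕜) :
    negOp B (k + 1) x (consOp B v w) =
      negOp B k (negSucc 𝕜 g V k x v) w +
        (-1 : 𝕜) ^ (k + 1) • consOp B v (negOp B (k + 1) x w) := by
  have : (consOp B).compr₂ (negOp B (k + 1) x) =
      negOp B k ∘ₗ negSucc 𝕜 g V k x +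
        (-1 : 𝕜) ^ (k + 1) • (consOp B).compl₂ (negOp B (k + 1) x) := by
    refine B.ext fun b => ?_
    ext l : 2
    simp [consOp_basis, negOp_single, wordOp]
  exact LinearMap.congr_fun₂ this v w

theorem negSucc_negBr_zero_succ (m k : ℕ) (h : 0 + (k + 1) = m + 1) (x : Neg 𝕜 g V 0)
    (y : Neg 𝕜 g V (k + 1)) (v : V) :
    negSucc 𝕜 g V m (negBr 𝕜 g V (m + 1) 0 (k + 1) h x y) v =
      negBr 𝕜 g V m 0 k (by omega) x (negSucc 𝕜 g V k y v) -
        negCast 𝕜 g V (by omega) (negSucc 𝕜 g V k y ⁅(negZero 𝕜 g V).symm x, v⁆) := by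
  rw [negBr]
  simp

theorem negSucc_negBr_succ_zero (m j : ℕ) (h : j + 1 + 0 = m + 1) (x : Neg 𝕜 g V (j + 1))
    (y : Neg 𝕜 g V 0) (v : V) :
    negSucc 𝕜 g V m (negBr 𝕜 g V (m + 1) (j + 1) 0 h x y) v =
      negCast 𝕜 g V (by omega) (negSucc 𝕜 g V j x ⁅(negZero 𝕜 g V).symm y, v⁆) +
        negBr 𝕜 g V m j 0 (by omega) (negSucc 𝕜 g V j x v) y := by
  rw [negBr]
  simp

theorem negSucc_negBr_succ_succ (m j k : ℕ) (h : j + 1 + (k + 1) = m + 1) (x : Neg 𝕜 g V (j + 1))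
    (y : Neg 𝕜 g V (k + 1)) (v : V) :
    negSucc 𝕜 g V m (negBr 𝕜 g V (m + 1) (j + 1) (k + 1) h x y) v =
      negBr 𝕜 g V m (j + 1) k (by omega) x (negSucc 𝕜 g V k y v) +
        (-1 : 𝕜) ^ (k + 1) • negBr 𝕜 g V m j (k + 1) (by omega) (negSucc 𝕜 g V j x v) y := by
  rw [negBr]
  simp

theorem negZero_symm_negBr (x y : Neg 𝕜 g V 0) (h : 0 + 0 = 0) :
    (negZero 𝕜 g V).symm (negBr 𝕜 g V 0 0 0 h x y) =
      ⁅(negZero 𝕜 g V).symm x, (negZero 𝕜 g V).symm y⁆ := by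
  rw [negBr]
  simp

/-- Nonpositive elements all kill the empty word, which starts an induction on the length of the
word. To pass from $w$ to $vw$, move both operators past $v$: the terms with $[x,v]$ and $[y,v]$
match the recursive definition of $[x,y](v)$, and the rest is the claim on $w$. Passing to $x(v)$
lowers degrees, so the degrees stay quantified in the induction. -/
theorem negOp_negBr (l : List ι) : ∀ (m j k : ℕ) (h : j + k = m) (x : Neg 𝕜 g V j)
    (y : Neg 𝕜 g V k), negOp B m (negBr 𝕜 g V m j k h x y) (Finsupp.single l 1) =
      negOp B j x (negOp B k y (Finsupp.single l 1)) -
        (-1 : 𝕜) ^ (j * k) • negOp B k y (negOp B j x (Finsupp.single l 1)) := by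
  induction l with
  | nil => intros; simp [negOp_single, wordOp]
  | cons b l ih =>
    intro m j k h x y
    rw [← consOp_basis B]
    set w : List ι →₀ 𝕜 := Finsupp.single l 1
    match m, j, k, h with
    | 0, 0, 0, h =>
      simp only [negOp_zero_consOp, ih, negZero_symm_negBr, map_add, map_sub, lie_lie,
        LinearMap.sub_apply, pow_zero, one_smul, mul_zero]
      abel
    | 0, j + 1, k, h => omega
    | m + 1, 0, k + 1, h =>
      -- With the indices identified, `negCast` becomes the identity.
      obtain rfl : k = m := by omega
      simp only [negOp_succ_consOp, negOp_zero_consOp, ih, negSucc_negBr_zero_succ, map_add,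
        map_sub, map_smul, LinearMap.sub_apply, negCast_rfl, zero_mul, pow_zero, one_smul]
      module
    | m + 1, j + 1, 0, h =>
      obtain rfl : j = m := by omega
      simp only [negOp_succ_consOp, negOp_zero_consOp, ih, negSucc_negBr_succ_zero, map_add,
        map_sub, map_smul, LinearMap.add_apply, negCast_rfl, mul_zero, pow_zero, one_smul]
      module
    | m + 1, j + 1, k + 1, h =>
      obtain rfl : j + k + 1 = m := by omega
      simp only [negOp_succ_consOp, ih, negSucc_negBr_succ_succ, map_add,
        map_sub, map_smul, LinearMap.add_apply, LinearMap.smul_apply, smul_add, smul_sub, smul_smul]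
      obtain hj | hj := neg_one_pow_eq_or 𝕜 j <;> obtain hk | hk := neg_one_pow_eq_or 𝕜 k <;>
      simp only [pow_succ, pow_add, mul_add, add_mul, pow_mul, one_mul, mul_one, hj, hk,
        one_pow, mul_neg, neg_neg] <;> module

theorem negOp_negBr_eq (j k : ℕ) (x : Neg 𝕜 g V j) (y : Neg 𝕜 g V k) :
    negOp B (j + k) (negBr 𝕜 g V (j + k) j k rfl x y) =
      negOp B j x * negOp B k y - (-1 : 𝕜) ^ (j * k) • (negOp B k y * negOp B j x) := by
  ext l : 2
  simpa using negOp_negBr B l (j + k) j k rfl x y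

end Model

/-! ### The generators embed in the presented algebra. -/

section Injective

variable {𝕜 : Type*} {g : Type*} {V : Type*} [Field 𝕜] [LieRing g] [LieAlgebra 𝕜 g]
  [AddCommGroup V] [Module 𝕜 V] [LieRingModule g V] [LieModule 𝕜 g V]

theorem negOnePow_smul {G : Type*} [AddCommGroup G] [Module 𝕜 G] (n : ℕ) (x : G) :
    (n : ℤ).negOnePow • x = (-1 : 𝕜) ^ n • x := by
  obtain h | h := Nat.even_or_odd n
  · rw [Int.negOnePow_even _ (by exact_mod_cast h), h.neg_one_pow, one_smul, one_smul]
  · rw [Int.negOnePow_odd _ (by exact_mod_cast h), h.neg_one_pow, Units.neg_smul, one_smul,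
      neg_one_smul]

/-- Operators representing the generators in an associative algebra give a map from the presented
Lie superalgebra. -/
theorem FreeExt.exists_lift_superComm {A : Type*} [Ring A] [Algebra 𝕜 A] (c : V →ₗ[𝕜] A)
    (n : ∀ k, Neg 𝕜 g V k →ₗ[𝕜] A)
    (zero_pos : ∀ x v, n 0 x * c v - c v * n 0 x = c ⁅(negZero 𝕜 g V).symm x, v⁆)
    (succ_pos : ∀ k x v, n (k + 1) x * c v - (-1 : 𝕜) ^ (k + 1) • (c v * n (k + 1) x) =
      n k (negSucc 𝕜 g V k x v))
    (neg_neg : ∀ j k x y, n j x * n k y - (-1 : 𝕜) ^ (j * k) • (n k y * n j x) =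
      n (j + k) (negBr 𝕜 g V (j + k) j k rfl x y)) :
    ∃ Φ : FreeExt 𝕜 g V →ₗ[𝕜] A × A,
      ∀ v, Φ (FreeExt.pos 𝕜 g V v) = parityIncl 𝕜 A 1 (c v) := by
  -- The subspaces attached to the degrees depend only on parity, so they are not independent. The
  -- universal property needs them only to be compatible with the bracket.
  have lift := FreeExt.exists_lift (g := g) (V := V) (superComm 𝕜 A)
    (fun k => LinearMap.range (parityIncl 𝕜 A k))
  refine (lift ?_ ?_ ?_ (parityIncl 𝕜 A 1 ∘ₗ c) (fun k => parityIncl 𝕜 A (-k) ∘ₗ n k)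
    (fun v => ⟨_, rfl⟩) (fun k x => ⟨_, rfl⟩) ?_ ?_ ?_).imp fun Φ h => h.1
  · rintro i j _ ⟨a, rfl⟩ _ ⟨b, rfl⟩
    exact ⟨_, (superComm_parityIncl i j a b).symm⟩
  · rintro i j _ ⟨a, rfl⟩ _ ⟨b, rfl⟩
    exact superComm_antisymm i j a b
  · rintro i j l _ ⟨a, rfl⟩ _ ⟨b, rfl⟩ _ ⟨c, rfl⟩
    exact superComm_jacobi i j l a b c
  · intro x v
    simp [superComm_parityIncl, ← zero_pos]
  · intro k x v
    simp only [LinearMap.comp_apply, superComm_parityIncl]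
    rw [show (-((k + 1 : ℕ) : ℤ) + 1) = -k by push_cast; ring, mul_one, Int.negOnePow_neg,
      negOnePow_smul (𝕜 := 𝕜), succ_pos]
  · intro j k x y
    simp only [LinearMap.comp_apply, superComm_parityIncl]
    rw [neg_mul_neg, ← Nat.cast_mul, negOnePow_smul (𝕜 := 𝕜), neg_neg, Nat.cast_add,
      _root_.neg_add]

/-- In the tensor algebra model, `v` acts as left multiplication, and applying this operator to the
empty word recovers the coordinates of `v`. -/
theorem FreeExt.pos_injective : Function.Injective (FreeExt.pos 𝕜 g V) := by
  let B := Module.Basis.ofVectorSpace 𝕜 V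
  have lift := FreeExt.exists_lift_superComm (g := g)
    (A := Module.End 𝕜 (List (Module.Basis.ofVectorSpaceIndex 𝕜 V) →₀ 𝕜)) (consOp B) (fun k => negOp B k)
  obtain ⟨Φ, hΦ⟩ := lift
    (fun x v => LinearMap.ext fun w => by simp [negOp_zero_consOp])
    (fun k x v => LinearMap.ext fun w => by simp [negOp_succ_consOp])
    (fun j k x y => (negOp_negBr_eq B j k x y).symm)
  intro u v huv
  have h := congrArg Φ huv
  rw [hΦ, hΦ] at h
  have h1 := congrArg (fun f => f (Finsupp.single [] 1)) (parityIncl_injective 1 h)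
  have key : ∀ v : V, consOp B v (Finsupp.single [] 1) =
      Finsupp.lmapDomain 𝕜 𝕜 (fun b => [b]) (B.repr v) := by
    intro v
    have : (consOp B).flip (Finsupp.single [] 1) =
        Finsupp.lmapDomain 𝕜 𝕜 (fun b => [b]) ∘ₗ B.repr.toLinearMap := by
      refine B.ext fun b => ?_
      simp [consOp_basis]
    exact LinearMap.congr_fun this v
  simp only [key] at h1
  exact B.repr.injective (Finsupp.mapDomain_injective (fun a b hab => by simpa using hab) h1)

theorem FreeExt.pos_deg (v : V) : FreeExt.pos 𝕜 g V v ∈ deg 𝕜 (FreeExt 𝕜 g V) 1 :=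
  ⟨_, fpos_mem 𝕜 g V v, rfl⟩

theorem FreeExt.neg_deg (k : ℕ) (x : Neg 𝕜 g V k) :
    FreeExt.neg 𝕜 g V k x ∈ deg 𝕜 (FreeExt 𝕜 g V) (-k) :=
  ⟨_, fneg_mem 𝕜 g V x, rfl⟩

theorem FreeExt.br_zero_pos (x : Neg 𝕜 g V 0) (v : V) :
    br 𝕜 (FreeExt.neg 𝕜 g V 0 x) (FreeExt.pos 𝕜 g V v) =
      FreeExt.pos 𝕜 g V ⁅(negZero 𝕜 g V).symm x, v⁆ :=
  sub_eq_zero.1 ((Submodule.Quotient.mk_eq_zero _).2 (rel_mem 𝕜 g V (Rel.zero_pos x v)))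

theorem FreeExt.br_succ_pos (k : ℕ) (x : Neg 𝕜 g V (k + 1)) (v : V) :
    br 𝕜 (FreeExt.neg 𝕜 g V (k + 1) x) (FreeExt.pos 𝕜 g V v) =
      FreeExt.neg 𝕜 g V k (negSucc 𝕜 g V k x v) :=
  sub_eq_zero.1 ((Submodule.Quotient.mk_eq_zero _).2 (rel_mem 𝕜 g V (Rel.succ_pos x v)))

theorem FreeExt.br_neg_neg (j k : ℕ) (x : Neg 𝕜 g V j) (y : Neg 𝕜 g V k) :
    br 𝕜 (FreeExt.neg 𝕜 g V j x) (FreeExt.neg 𝕜 g V k y) =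
      FreeExt.neg 𝕜 g V (j + k) (negBr 𝕜 g V (j + k) j k rfl x y) :=
  sub_eq_zero.1 ((Submodule.Quotient.mk_eq_zero _).2 (rel_mem 𝕜 g V (Rel.neg_neg x y)))

/-- Bracketing with `V` reduces degree $-k-1$ to degree $-k$ and finally degree $0$ to `V` itself,
where faithfulness turns equality of actions into equality in `g`. -/
theorem FreeExt.neg_injective (hV : Function.Injective (LieModule.toEnd 𝕜 g V)) (k : ℕ) :
    Function.Injective (FreeExt.neg 𝕜 g V k) := by
  induction k with
  | zero =>
    rw [injective_iff_map_eq_zero]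
    intro x hx
    rw [← (negZero 𝕜 g V).symm.map_eq_zero_iff]
    refine hV ?_
    ext v
    rw [map_zero, LinearMap.zero_apply, LieModule.toEnd_apply_apply]
    refine FreeExt.pos_injective (𝕜 := 𝕜) (g := g) ?_
    rw [← FreeExt.br_zero_pos, hx]
    simp
  | succ k ih =>
    rw [injective_iff_map_eq_zero] at ih ⊢
    intro x hx
    rw [← (negSucc 𝕜 g V k).map_eq_zero_iff]
    ext1 v
    refine ih _ ?_
    rw [← FreeExt.br_succ_pos, hx]
    simp

end Injective

/-! ### Description of the presented algebra in each degree; brackets in low degrees. -/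

section Span

variable {𝕜 : Type*} {g : Type*} {V : Type*} [Field 𝕜] [LieRing g] [LieAlgebra 𝕜 g]
  [AddCommGroup V] [Module 𝕜 V] [LieRingModule g V] [LieModule 𝕜 g V]

/-- A subspace which includes the generators and is closed under brackets of its homogeneous
elements is the whole space. -/
theorem FreeExt.mem_of_generators (W : Submodule 𝕜 (FreeExt 𝕜 g V))
    (hpos : ∀ v, FreeExt.pos 𝕜 g V v ∈ W) (hneg : ∀ k x, FreeExt.neg 𝕜 g V k x ∈ W)
    (hbr : ∀ i j, ∀ x ∈ W, ∀ y ∈ W, x ∈ deg 𝕜 (FreeExt 𝕜 g V) i →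
      y ∈ deg 𝕜 (FreeExt 𝕜 g V) j → br 𝕜 x y ∈ W) (x : FreeExt 𝕜 g V) : x ∈ W := by
  obtain ⟨x, rfl⟩ := (relIdeal 𝕜 g V).mkQ_surjective x
  change FreeExt.mk 𝕜 g V x ∈ W
  have single : ∀ m : FreeMagma (Gen 𝕜 g V), MonoidAlgebra.single m (1 : 𝕜) ∈
      freeDeg 𝕜 g V (wt Gen.degree m) ∧
        FreeExt.mk 𝕜 g V (MonoidAlgebra.single m (1 : 𝕜)) ∈ W := by
    intro m
    refine Free.induction
      (p := fun m a => a ∈ freeDeg 𝕜 g V (wt Gen.degree m) ∧ FreeExt.mk 𝕜 g V a ∈ W) ?_ ?_ m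
    · rintro (v | ⟨k, x⟩)
      · exact ⟨fpos_mem 𝕜 g V v, hpos v⟩
      · exact ⟨fneg_mem 𝕜 g V x, hneg k x⟩
    · intro m n a b ha hb
      exact ⟨freeDeg_mul 𝕜 g V ha.1 hb.1,
        hbr _ _ _ ha.2 _ hb.2 ⟨_, ha.1, rfl⟩ ⟨_, hb.1, rfl⟩⟩
  induction x using MonoidAlgebra.induction_linear with
  | zero => simp
  | add x y hx hy =>
    rw [map_add]
    exact add_mem hx hy
  | single m c =>
    have : MonoidAlgebra.single m c = c • (MonoidAlgebra.single m 1 : Free 𝕜 g V) := by simp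
    rw [this, map_smul]
    exact W.smul_mem c (single m).2

variable (𝕜 g V) in
/-- The span of the iterated brackets of `n + 1` elements of `V`. -/
def posPow : ℕ → Submodule 𝕜 (FreeExt 𝕜 g V)
  | 0 => LinearMap.range (FreeExt.pos 𝕜 g V)
  | n + 1 => ⨆ v, (posPow n).map (br 𝕜 (FreeExt.pos 𝕜 g V v))

theorem br_pos_mem_posPow (v : V) {n : ℕ} {w : FreeExt 𝕜 g V} (hw : w ∈ posPow 𝕜 g V n) :
    br 𝕜 (FreeExt.pos 𝕜 g V v) w ∈ posPow 𝕜 g V (n + 1) :=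
  Submodule.mem_iSup_of_mem v ⟨w, hw, rfl⟩

theorem posPow_le_deg (n : ℕ) : posPow 𝕜 g V n ≤ deg 𝕜 (FreeExt 𝕜 g V) (n + 1) := by
  induction n with
  | zero =>
    rintro _ ⟨v, rfl⟩
    simpa using FreeExt.pos_deg (𝕜 := 𝕜) (g := g) v
  | succ n ih =>
    refine iSup_le fun v => ?_
    rintro _ ⟨w, hw, rfl⟩
    have := br_deg (FreeExt.pos_deg (𝕜 := 𝕜) (g := g) v) (ih hw)
    rwa [add_comm 1, ← Nat.cast_succ] at this

variable (𝕜 g V) in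
/-- The span of the generators of nonpositive degree and of the iterated brackets of elements of
`V`. -/
def generatorSpan : Submodule 𝕜 (FreeExt 𝕜 g V) :=
  (⨆ k, LinearMap.range (FreeExt.neg 𝕜 g V k)) ⊔ ⨆ n, posPow 𝕜 g V n

theorem neg_mem_generatorSpan (k : ℕ) (x : Neg 𝕜 g V k) :
    FreeExt.neg 𝕜 g V k x ∈ generatorSpan 𝕜 g V :=
  Submodule.mem_sup_left (Submodule.mem_iSup_of_mem k ⟨x, rfl⟩)

theorem posPow_le_generatorSpan (n : ℕ) : posPow 𝕜 g V n ≤ generatorSpan 𝕜 g V :=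
  le_sup_of_le_right (le_iSup (posPow 𝕜 g V) n)

theorem pos_mem_generatorSpan (v : V) : FreeExt.pos 𝕜 g V v ∈ generatorSpan 𝕜 g V :=
  posPow_le_generatorSpan 0 ⟨v, rfl⟩

theorem generatorSpan_le {W : Submodule 𝕜 (FreeExt 𝕜 g V)}
    (hneg : ∀ k x, FreeExt.neg 𝕜 g V k x ∈ W) (hpos : ∀ n, posPow 𝕜 g V n ≤ W) :
    generatorSpan 𝕜 g V ≤ W := by
  refine sup_le (iSup_le fun k => ?_) (iSup_le hpos)
  rintro _ ⟨x, rfl⟩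
  exact hneg k x

theorem br_neg_pos_mem (k : ℕ) (x : Neg 𝕜 g V k) (v : V) :
    br 𝕜 (FreeExt.neg 𝕜 g V k x) (FreeExt.pos 𝕜 g V v) ∈ generatorSpan 𝕜 g V := by
  cases k with
  | zero =>
    rw [FreeExt.br_zero_pos]
    exact pos_mem_generatorSpan _
  | succ k =>
    rw [FreeExt.br_succ_pos]
    exact neg_mem_generatorSpan _ _

theorem br_pos_mem_generatorSpan (v : V) {w : FreeExt 𝕜 g V} (hw : w ∈ generatorSpan 𝕜 g V) :
    br 𝕜 (FreeExt.pos 𝕜 g V v) w ∈ generatorSpan 𝕜 g V := by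
  have : generatorSpan 𝕜 g V ≤ (generatorSpan 𝕜 g V).comap (br 𝕜 (FreeExt.pos 𝕜 g V v)) :=
    generatorSpan_le
      (fun k x => br_mem_swap (FreeExt.neg_deg k x) (FreeExt.pos_deg v) (br_neg_pos_mem k x v))
      fun n w hw => posPow_le_generatorSpan _ (br_pos_mem_posPow v hw)
  exact this hw

/-- By the Jacobi identity $[x,[v,w]]=[[x,v],w]\pm[v,[x,w]]$, where $[x,v]$ is in `V` or again a
generator of nonpositive degree. The induction on the length of $w$ is therefore uniform in $x$ and
its degree. -/
theorem br_neg_mem_generatorSpan (k : ℕ) (x : Neg 𝕜 g V k) {w : FreeExt 𝕜 g V}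
    (hw : w ∈ generatorSpan 𝕜 g V) :
    br 𝕜 (FreeExt.neg 𝕜 g V k x) w ∈ generatorSpan 𝕜 g V := by
  have hpow : ∀ n k (x : Neg 𝕜 g V k), posPow 𝕜 g V n ≤
      (generatorSpan 𝕜 g V).comap (br 𝕜 (FreeExt.neg 𝕜 g V k x)) := by
    intro n
    induction n with
    | zero =>
      rintro k x _ ⟨v, rfl⟩
      exact br_neg_pos_mem k x v
    | succ n ih =>
      refine fun k x => iSup_le fun v => ?_
      rintro _ ⟨w, hw, rfl⟩
      rw [Submodule.mem_comap, br_br w (FreeExt.neg_deg k x) (FreeExt.pos_deg v)]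
      refine add_mem ?_ (units_smul_mem _ _ (br_pos_mem_generatorSpan v (ih k x hw)))
      cases k with
      | zero =>
        rw [FreeExt.br_zero_pos]
        exact posPow_le_generatorSpan _ (br_pos_mem_posPow _ hw)
      | succ k =>
        rw [FreeExt.br_succ_pos]
        exact ih k _ hw
  have : generatorSpan 𝕜 g V ≤ (generatorSpan 𝕜 g V).comap (br 𝕜 (FreeExt.neg 𝕜 g V k x)) :=
    generatorSpan_le (fun j y => by
      rw [Submodule.mem_comap, FreeExt.br_neg_neg]
      exact neg_mem_generatorSpan _ _) fun n => hpow n k x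
  exact this hw

/-- The elements whose brackets preserve the span include the generators and, by the Jacobi
identity, are closed under brackets, so they are all elements. Hence the span is itself closed under
brackets, and it includes the generators. -/
theorem mem_generatorSpan (x : FreeExt 𝕜 g V) : x ∈ generatorSpan 𝕜 g V := by
  let S : Submodule 𝕜 (FreeExt 𝕜 g V) :=
    { carrier := {x | ∀ w ∈ generatorSpan 𝕜 g V, br 𝕜 x w ∈ generatorSpan 𝕜 g V}
      add_mem' := fun {x y} hx hy w hw => by
        rw [map_add]
        exact add_mem (hx w hw) (hy w hw)
      zero_mem' := fun w _ => by simp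
      smul_mem' := fun c x hx w hw => by
        rw [map_smul]
        exact Submodule.smul_mem _ _ (hx w hw) }
  have hS : ∀ x, x ∈ S := by
    refine FreeExt.mem_of_generators S (fun v w => br_pos_mem_generatorSpan v)
      (fun k x w => br_neg_mem_generatorSpan k x) ?_
    intro i j x hx y hy hxi hyj w hw
    rw [← GradedLieSuperalgebra.jacobi w hxi hyj]
    exact sub_mem (hx _ (hy w hw)) (units_smul_mem _ _ (hy _ (hx w hw)))
  exact FreeExt.mem_of_generators _ pos_mem_generatorSpan neg_mem_generatorSpan
    (fun i j x _ y hy _ _ => hS x y hy) x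

theorem exists_neg_of_mem_deg {k : ℕ} {x : FreeExt 𝕜 g V}
    (hx : x ∈ deg 𝕜 (FreeExt 𝕜 g V) (-k)) : ∃ y, x = FreeExt.neg 𝕜 g V k y := by
  have : generatorSpan 𝕜 g V ≤ (LinearMap.range (FreeExt.neg 𝕜 g V k)).comap
      (proj 𝕜 (FreeExt 𝕜 g V) (-k)) := by
    refine generatorSpan_le (fun j y => ?_) fun n w hw => ?_
    · rw [Submodule.mem_comap]
      by_cases h : j = k
      · subst h
        rw [proj_same (FreeExt.neg_deg j y)]
        exact ⟨y, rfl⟩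
      · rw [proj_ne (by omega) (FreeExt.neg_deg j y)]
        exact zero_mem _
    · rw [Submodule.mem_comap, proj_ne (by omega) (posPow_le_deg n hw)]
      exact zero_mem _
  obtain ⟨y, hy⟩ := this (mem_generatorSpan x)
  exact ⟨y, by rw [hy, proj_same hx]⟩

theorem mem_posPow_of_mem_deg {n : ℕ} {x : FreeExt 𝕜 g V}
    (hx : x ∈ deg 𝕜 (FreeExt 𝕜 g V) (n + 1)) : x ∈ posPow 𝕜 g V n := by
  have : generatorSpan 𝕜 g V ≤ (posPow 𝕜 g V n).comap (proj 𝕜 (FreeExt 𝕜 g V) (n + 1)) := by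
    refine generatorSpan_le (fun j y => ?_) fun m w hw => ?_
    · rw [Submodule.mem_comap, proj_ne (by omega) (FreeExt.neg_deg j y)]
      exact zero_mem _
    · rw [Submodule.mem_comap]
      by_cases h : m = n
      · subst h
        rwa [proj_same (posPow_le_deg m hw)]
      · rw [proj_ne (by omega) (posPow_le_deg m hw)]
        exact zero_mem _
  rw [← proj_same hx]
  exact this (mem_generatorSpan x)

theorem exists_pos_of_mem_deg {x : FreeExt 𝕜 g V} (hx : x ∈ deg 𝕜 (FreeExt 𝕜 g V) 1) :
    ∃ v, x = FreeExt.pos 𝕜 g V v := by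
  obtain ⟨v, hv⟩ := mem_posPow_of_mem_deg (n := 0) (by simpa using hx)
  exact ⟨v, hv.symm⟩

variable (𝕜 g V) in
/-- The bracket of elements of `V`, as a map on the tensor square of `V`. -/
def brTensor : TensorProduct 𝕜 V V →ₗ[𝕜] FreeExt 𝕜 g V :=
  TensorProduct.lift
    ((br 𝕜 (G := FreeExt 𝕜 g V)).compl₁₂ (FreeExt.pos 𝕜 g V) (FreeExt.pos 𝕜 g V))

theorem brTensor_tmul (u v : V) : brTensor 𝕜 g V (TensorProduct.tmul 𝕜 u v) =
    br 𝕜 (FreeExt.pos 𝕜 g V u) (FreeExt.pos 𝕜 g V v) := rfl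

theorem exists_brTensor_of_mem_deg {x : FreeExt 𝕜 g V} (hx : x ∈ deg 𝕜 (FreeExt 𝕜 g V) 2) :
    ∃ t, x = brTensor 𝕜 g V t := by
  have : posPow 𝕜 g V 1 ≤ LinearMap.range (brTensor 𝕜 g V) := by
    refine iSup_le fun u => ?_
    rintro _ ⟨_, ⟨v, rfl⟩, rfl⟩
    exact ⟨TensorProduct.tmul 𝕜 u v, rfl⟩
  obtain ⟨t, ht⟩ := this (mem_posPow_of_mem_deg (n := 1) hx)
  exact ⟨t, ht.symm⟩

theorem brTensor_mem_deg (t : TensorProduct 𝕜 V V) :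
    brTensor 𝕜 g V t ∈ deg 𝕜 (FreeExt 𝕜 g V) 2 := by
  induction t with
  | zero =>
    rw [map_zero]
    exact zero_mem _
  | tmul u v =>
    rw [brTensor_tmul, ← one_add_one_eq_two]
    exact br_deg (FreeExt.pos_deg u) (FreeExt.pos_deg v)
  | add x y hx hy =>
    rw [map_add]
    exact add_mem hx hy

theorem FreeExt.zero_apply (x : g) :
    FreeExt.zero 𝕜 g V x = FreeExt.neg 𝕜 g V 0 (negZero 𝕜 g V x) := rfl

theorem FreeExt.hom_apply (φ : V →ₗ[𝕜] g) : FreeExt.hom 𝕜 g V φ =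
    FreeExt.neg 𝕜 g V 1 ((negSucc 𝕜 g V 0).symm ((negZero 𝕜 g V).toLinearMap ∘ₗ φ)) := rfl

theorem FreeExt.zero_deg (x : g) : FreeExt.zero 𝕜 g V x ∈ deg 𝕜 (FreeExt 𝕜 g V) 0 := by
  have h := FreeExt.neg_deg (V := V) 0 (negZero 𝕜 g V x)
  rwa [Nat.cast_zero, neg_zero] at h

theorem FreeExt.hom_deg (φ : V →ₗ[𝕜] g) :
    FreeExt.hom 𝕜 g V φ ∈ deg 𝕜 (FreeExt 𝕜 g V) (-1) := by
  rw [FreeExt.hom_apply, ← Nat.cast_one]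
  exact FreeExt.neg_deg 1 _

theorem FreeExt.br_zero (x : g) (v : V) :
    br 𝕜 (FreeExt.zero 𝕜 g V x) (FreeExt.pos 𝕜 g V v) = FreeExt.pos 𝕜 g V ⁅x, v⁆ := by
  rw [FreeExt.zero_apply, FreeExt.br_zero_pos, LinearEquiv.symm_apply_apply]

theorem FreeExt.br_hom (φ : V →ₗ[𝕜] g) (v : V) :
    br 𝕜 (FreeExt.hom 𝕜 g V φ) (FreeExt.pos 𝕜 g V v) = FreeExt.zero 𝕜 g V (φ v) := by
  refine (FreeExt.br_succ_pos 0 _ v).trans ?_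
  simp [FreeExt.zero]

/-- The bracket of degrees $0$ and $-1$ is the standard action on `Hom(V, g)`, so that the cyclic
submodule generated by `Θ` can be handled inside the superalgebra. -/
theorem FreeExt.br_zero_hom (x : g) (φ : V →ₗ[𝕜] g) :
    br 𝕜 (FreeExt.zero 𝕜 g V x) (FreeExt.hom 𝕜 g V φ) = FreeExt.hom 𝕜 g V ⁅x, φ⁆ := by
  refine (FreeExt.br_neg_neg 0 1 _ _).trans ?_
  refine congrArg (FreeExt.neg 𝕜 g V 1) ?_
  refine (negSucc 𝕜 g V 0).injective ?_
  ext1 v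
  refine (negSucc_negBr_zero_succ 0 0 rfl _ _ v).trans ?_
  refine (negZero 𝕜 g V).symm.injective ?_
  rw [map_sub, negCast_rfl, negZero_symm_negBr]
  simp

end Span

/-! ### Functoriality in the Lie algebra acting on `V`. -/

section Functorial

variable {𝕜 : Type*} {g g' : Type*} {V : Type*} [Field 𝕜] [LieRing g] [LieAlgebra 𝕜 g]
  [LieRing g'] [LieAlgebra 𝕜 g'] [AddCommGroup V] [Module 𝕜 V]

variable (V) in
/-- The map between spaces of multilinear maps given by composition. -/
def negMap (f : g →ₗ[𝕜] g') (k : ℕ) : Neg 𝕜 g V k →ₗ[𝕜] Neg 𝕜 g' V k where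
  toFun x := f.compMultilinearMap x
  map_add' x y := by ext; simp
  map_smul' c x := by ext; simp

theorem negZero_symm_negMap (f : g →ₗ[𝕜] g') (x : Neg 𝕜 g V 0) :
    (negZero 𝕜 g' V).symm (negMap V f 0 x) = f ((negZero 𝕜 g V).symm x) := rfl

theorem negSucc_negMap (f : g →ₗ[𝕜] g') (k : ℕ) (x : Neg 𝕜 g V (k + 1)) (v : V) :
    negSucc 𝕜 g' V k (negMap V f (k + 1) x) v = negMap V f k (negSucc 𝕜 g V k x v) := rfl

theorem negMap_injective {f : g →ₗ[𝕜] g'} (hf : Function.Injective f) (k : ℕ) :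
    Function.Injective (negMap V f k) := fun x y h => by
  ext v
  exact hf (congrArg (fun z => z v) h)

theorem negMap_negCast (f : g →ₗ[𝕜] g') {k m : ℕ} (h : k = m) (x : Neg 𝕜 g V k) :
    negMap V f m (negCast 𝕜 g V h x) = negCast 𝕜 g' V h (negMap V f k x) := by
  subst h
  rfl

variable [LieRingModule g V] [LieModule 𝕜 g V] [LieRingModule g' V] [LieModule 𝕜 g' V]

/-- The recursion for the bracket uses only evaluation at vectors, the action on `V` and the Lie
bracket in degree $0$. All three are respected by `f`, so evaluating both sides at `v` reduces the
claim to lower degree. -/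
theorem negMap_negBr (f : g →ₗ⁅𝕜⁆ g') (hf : ∀ x (v : V), ⁅f x, v⁆ = ⁅x, v⁆) :
    ∀ (m j k : ℕ) (h : j + k = m) (x : Neg 𝕜 g V j) (y : Neg 𝕜 g V k),
      negMap V (f : g →ₗ[𝕜] g') m (negBr 𝕜 g V m j k h x y) =
        negBr 𝕜 g' V m j k h (negMap V (f : g →ₗ[𝕜] g') j x) (negMap V (f : g →ₗ[𝕜] g') k y) := by
  intro m
  induction m with
  | zero =>
    intro j k h x y
    obtain rfl : j = 0 := by omega
    obtain rfl : k = 0 := by omega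
    refine (negZero 𝕜 g' V).symm.injective ?_
    rw [negZero_symm_negMap, negZero_symm_negBr, negZero_symm_negBr, negZero_symm_negMap,
      negZero_symm_negMap]
    simp
  | succ m ih =>
    intro j k h x y
    refine (negSucc 𝕜 g' V m).injective ?_
    ext1 v
    rw [negSucc_negMap]
    match j, k, h with
    | 0, k + 1, h =>
      rw [negSucc_negBr_zero_succ, negSucc_negBr_zero_succ, map_sub, ih, negMap_negCast,
        negSucc_negMap, negSucc_negMap, negZero_symm_negMap]
      simp [hf]
    | j + 1, 0, h =>
      rw [negSucc_negBr_succ_zero, negSucc_negBr_succ_zero, map_add, ih, negMap_negCast,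
        negSucc_negMap, negSucc_negMap, negZero_symm_negMap]
      simp [hf]
    | j + 1, k + 1, h =>
      rw [negSucc_negBr_succ_succ, negSucc_negBr_succ_succ, map_add, map_smul, ih, ih,
        negSucc_negMap, negSucc_negMap]

/-- A homomorphism of Lie algebras acting on `V` induces a homomorphism of the associated Lie
superalgebras. -/
theorem FreeExt.exists_map (f : g →ₗ⁅𝕜⁆ g') (hf : ∀ x (v : V), ⁅f x, v⁆ = ⁅x, v⁆) :
    ∃ F : GLSHom 𝕜 (FreeExt 𝕜 g V) (FreeExt 𝕜 g' V),
      (∀ v, F.toLinearMap (FreeExt.pos 𝕜 g V v) = FreeExt.pos 𝕜 g' V v) ∧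
        ∀ k x, F.toLinearMap (FreeExt.neg 𝕜 g V k x) =
          FreeExt.neg 𝕜 g' V k (negMap V (f : g →ₗ[𝕜] g') k x) := by
  obtain ⟨Φ, h1, h2, h3, h4⟩ := FreeExt.exists_lift (g := g) (V := V)
    (br 𝕜 (G := FreeExt 𝕜 g' V)) (deg 𝕜 (FreeExt 𝕜 g' V)) (fun i j x hx y hy => br_deg hx hy)
    (fun i j x hx y hy => GradedLieSuperalgebra.antisymm hx hy)
    (fun i j l x hx y hy z _ => GradedLieSuperalgebra.jacobi z hx hy)
    (FreeExt.pos 𝕜 g' V) (fun k => FreeExt.neg 𝕜 g' V k ∘ₗ negMap V (f : g →ₗ[𝕜] g') k)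
    FreeExt.pos_deg (fun k x => FreeExt.neg_deg k _)
    (fun x v => by
      rw [LinearMap.comp_apply, FreeExt.br_zero_pos, negZero_symm_negMap]
      exact congrArg _ (hf _ v))
    (fun k x v => by
      rw [LinearMap.comp_apply, FreeExt.br_succ_pos, negSucc_negMap, LinearMap.comp_apply])
    (fun j k x y => by
      simp only [LinearMap.comp_apply]
      rw [FreeExt.br_neg_neg, negMap_negBr f hf])
  exact ⟨{ Φ with map_deg := h4, map_br := h3 }, h1, h2⟩

end Functorial

/-! ### Ideals from one-sided conditions, and stabilizers of subspaces. -/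

section Ideals

variable {𝕜 : Type*} {G : Type*} [Field 𝕜] [AddCommGroup G] [Module 𝕜 G]
  [GradedLieSuperalgebra 𝕜 G]

/-- A homogeneous subspace closed under left multiplication is an ideal. -/
def GIdeal.ofLeft (W : Submodule 𝕜 G) (hom : ∀ k, ∀ x ∈ W, proj 𝕜 G k x ∈ W)
    (left : ∀ x, ∀ y ∈ W, br 𝕜 x y ∈ W) : GIdeal 𝕜 G where
  toSubmodule := W
  homogeneous := hom
  br_mem_left := left
  br_mem_right x y hy := by
    have h1 : y ∈ W.comap ((br 𝕜).flip x) := by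
      refine mem_of_proj_mem fun i => ?_
      change x ∈ W.comap (br 𝕜 (proj 𝕜 G i y))
      refine mem_of_proj_mem fun j => ?_
      exact br_mem_swap (proj_mem j x) (proj_mem i y) (left _ _ (hom i y hy))
    exact h1

/-- The inclusion of a subalgebra. -/
def GSubalgebra.incl (H : GSubalgebra 𝕜 G) : GLSHom 𝕜 H.toSubmodule G where
  toLinearMap := H.toSubmodule.subtype
  map_deg _ _ hx := hx
  map_br _ _ := rfl

theorem GSubalgebra.coe_proj (H : GSubalgebra 𝕜 G) (k : ℤ) (x : H.toSubmodule) :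
    ((proj 𝕜 H.toSubmodule k x : H.toSubmodule) : G) = proj 𝕜 G k (x : G) :=
  H.incl.map_proj k x

theorem GSubalgebra.coe_br (H : GSubalgebra 𝕜 G) (x y : H.toSubmodule) :
    ((br 𝕜 x y : H.toSubmodule) : G) = br 𝕜 (x : G) (y : G) := rfl

theorem GSubalgebra.mem_deg (H : GSubalgebra 𝕜 G) {k : ℤ} {x : H.toSubmodule} :
    x ∈ deg 𝕜 H.toSubmodule k ↔ (x : G) ∈ deg 𝕜 G k := Iff.rfl

/-- The elements whose left multiplication preserves a subspace. -/
def leftStabilizer (W : Submodule 𝕜 G) : Submodule 𝕜 G where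
  carrier := {x | ∀ w ∈ W, br 𝕜 x w ∈ W}
  add_mem' {x y} hx hy w hw := by
    rw [map_add]
    exact add_mem (hx w hw) (hy w hw)
  zero_mem' w _ := by simp
  smul_mem' c x hx w hw := by
    rw [map_smul]
    exact Submodule.smul_mem _ _ (hx w hw)

theorem br_mem_leftStabilizer (W : Submodule 𝕜 G) {i j : ℤ} {x y : G} (hx : x ∈ leftStabilizer W)
    (hy : y ∈ leftStabilizer W) (hxi : x ∈ deg 𝕜 G i) (hyj : y ∈ deg 𝕜 G j) :
    br 𝕜 x y ∈ leftStabilizer W := fun w hw => by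
  rw [← GradedLieSuperalgebra.jacobi w hxi hyj]
  exact sub_mem (hx _ (hy w hw)) (units_smul_mem _ _ (hy _ (hx w hw)))

end Ideals

/-! ### The module `K`, and ideals of `TTilde Θ` missing the local part. -/

section Triple

variable {𝕜 : Type*} {g : Type*} {V : Type*} [Field 𝕜] [LieRing g] [LieAlgebra 𝕜 g]
  [AddCommGroup V] [Module 𝕜 V] [LieRingModule g V] [LieModule 𝕜 g V] (Θ : V →ₗ[𝕜] g)

theorem hom_mem_TTilde {φ : V →ₗ[𝕜] g} (hφ : φ ∈ cyclic Θ) :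
    FreeExt.hom 𝕜 g V φ ∈ (TTilde Θ).toSubmodule :=
  GSubalgebra.subset_closure _ (Or.inl (Or.inl ⟨φ, hφ, rfl⟩))

theorem zero_mem_TTilde (x : g) : FreeExt.zero 𝕜 g V x ∈ (TTilde Θ).toSubmodule :=
  GSubalgebra.subset_closure _ (Or.inl (Or.inr ⟨x, rfl⟩))

theorem pos_mem_TTilde (v : V) : FreeExt.pos 𝕜 g V v ∈ (TTilde Θ).toSubmodule :=
  GSubalgebra.subset_closure _ (Or.inr ⟨v, rfl⟩)

theorem self_mem_cyclic : Θ ∈ cyclic Θ := LieSubmodule.subset_lieSpan (Set.mem_singleton Θ)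

theorem TTilde_le (W : Submodule 𝕜 (FreeExt 𝕜 g V))
    (hhom : ∀ φ ∈ cyclic Θ, FreeExt.hom 𝕜 g V φ ∈ W) (hzero : ∀ x, FreeExt.zero 𝕜 g V x ∈ W)
    (hpos : ∀ v, FreeExt.pos 𝕜 g V v ∈ W)
    (hbr : ∀ i j, ∀ x ∈ W, ∀ y ∈ W, x ∈ deg 𝕜 (FreeExt 𝕜 g V) i →
      y ∈ deg 𝕜 (FreeExt 𝕜 g V) j → br 𝕜 x y ∈ W) : (TTilde Θ).toSubmodule ≤ W := by
  refine GSubalgebra.closure_le W ?_ ?_ hbr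
  · rintro _ ((⟨φ, -, rfl⟩ | ⟨x, rfl⟩) | ⟨v, rfl⟩)
    · exact ⟨_, FreeExt.hom_deg φ⟩
    · exact ⟨_, FreeExt.zero_deg x⟩
    · exact ⟨_, FreeExt.pos_deg v⟩
  · rintro _ ((⟨φ, hφ, rfl⟩ | ⟨x, rfl⟩) | ⟨v, rfl⟩)
    · exact hhom φ hφ
    · exact hzero x
    · exact hpos v

theorem symKer_eq :
    symKer Θ = (LinearMap.ker (TensorProduct.lift (symProd Θ))).map (brTensor 𝕜 g V) := rfl

/-- On $u\otimes v$ the Jacobi identity gives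
$[\Theta,[u,v]]=[\Theta(u),v]-[u,\Theta(v)]=\Theta(u)\cdot v+\Theta(v)\cdot u$. The kernel of the
symmetric product is thus what `Θ` annihilates in degree $2$. -/
theorem br_hom_brTensor (h2 : (2 : 𝕜) ≠ 0) (t : TensorProduct 𝕜 V V) :
    br 𝕜 (FreeExt.hom 𝕜 g V Θ) (brTensor 𝕜 g V t) =
      FreeExt.pos 𝕜 g V ((2 : 𝕜) • TensorProduct.lift (symProd Θ) t) := by
  induction t with
  | zero => simp only [map_zero, smul_zero]
  | tmul u v =>
    rw [brTensor_tmul, br_br _ (FreeExt.hom_deg Θ) (FreeExt.pos_deg u), FreeExt.br_hom,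
      FreeExt.br_hom, FreeExt.br_zero, br_comm (FreeExt.pos_deg u) (FreeExt.zero_deg (Θ v)),
      FreeExt.br_zero]
    simp [symProd, smul_smul, h2]
  | add x y hx hy => rw [map_add, map_add, hx, hy, map_add, smul_add, map_add]

theorem kerModule_le_symKer : kerModule Θ ≤ symKer Θ := sSup_le fun _ hW => hW.2

theorem br_zero_mem_kerModule (x : g) {w : FreeExt 𝕜 g V} (hw : w ∈ kerModule Θ) :
    br 𝕜 (FreeExt.zero 𝕜 g V x) w ∈ kerModule Θ := by
  have : kerModule Θ ≤ (kerModule Θ).comap (br 𝕜 (FreeExt.zero 𝕜 g V x)) :=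
    sSup_le fun W hW w hw => (le_sSup (a := W) hW) (hW.1 x w hw)
  exact this hw

theorem kerModule_le_deg : kerModule Θ ≤ deg 𝕜 (FreeExt 𝕜 g V) 2 := by
  intro w hw
  obtain ⟨t, -, rfl⟩ := kerModule_le_symKer Θ hw
  exact brTensor_mem_deg t

/-- Because `K` is stable under `g`, the maps annihilating it form a `g`-submodule of `Hom(V, g)`.
It contains `Θ`, hence the whole cyclic module. -/
theorem br_hom_kerModule (h2 : (2 : 𝕜) ≠ 0) {φ : V →ₗ[𝕜] g} (hφ : φ ∈ cyclic Θ)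
    {w : FreeExt 𝕜 g V} (hw : w ∈ kerModule Θ) : br 𝕜 (FreeExt.hom 𝕜 g V φ) w = 0 := by
  let S : LieSubmodule 𝕜 g (V →ₗ[𝕜] g) :=
    { carrier := {φ | ∀ w ∈ kerModule Θ, br 𝕜 (FreeExt.hom 𝕜 g V φ) w = 0}
      add_mem' := fun {x y} hx hy w hw => by
        rw [map_add, map_add, LinearMap.add_apply, hx w hw, hy w hw, add_zero]
      zero_mem' := fun w _ => by simp
      smul_mem' := fun c x hx w hw => by
        rw [map_smul, map_smul, LinearMap.smul_apply, hx w hw, smul_zero]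
      lie_mem := fun {x φ} hφ w hw => by
        rw [← FreeExt.br_zero_hom,
          ← GradedLieSuperalgebra.jacobi w (FreeExt.zero_deg x) (FreeExt.hom_deg φ), hφ w hw,
          hφ _ (br_zero_mem_kerModule Θ x hw)]
        simp }
  have : cyclic Θ ≤ S := by
    refine LieSubmodule.lieSpan_le.2 ?_
    rintro _ rfl w hw
    obtain ⟨t, ht, rfl⟩ := kerModule_le_symKer _ hw
    have ht' : TensorProduct.lift (symProd _) t = 0 := ht
    refine (br_hom_brTensor _ h2 t).trans ?_
    rw [ht', smul_zero, map_zero]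
  exact this hφ w hw

/-- The span of the iterated brackets of `n` elements of `V` with an element of `K`. -/
def kerPow : ℕ → Submodule 𝕜 (FreeExt 𝕜 g V)
  | 0 => kerModule Θ
  | n + 1 => ⨆ v, (kerPow n).map (br 𝕜 (FreeExt.pos 𝕜 g V v))

theorem br_pos_mem_kerPow (v : V) {n : ℕ} {w : FreeExt 𝕜 g V} (hw : w ∈ kerPow Θ n) :
    br 𝕜 (FreeExt.pos 𝕜 g V v) w ∈ kerPow Θ (n + 1) :=
  Submodule.mem_iSup_of_mem v ⟨w, hw, rfl⟩

theorem kerPow_le_deg (n : ℕ) : kerPow Θ n ≤ deg 𝕜 (FreeExt 𝕜 g V) (n + 2) := by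
  induction n with
  | zero =>
    rw [Nat.cast_zero, zero_add]
    exact kerModule_le_deg Θ
  | succ n ih =>
    refine iSup_le fun v => ?_
    rintro _ ⟨w, hw, rfl⟩
    have := br_deg (FreeExt.pos_deg (𝕜 := 𝕜) (g := g) v) (ih hw)
    rwa [← add_assoc, add_comm 1, ← Nat.cast_succ] at this

theorem br_zero_mem_kerPow (x : g) (n : ℕ) {w : FreeExt 𝕜 g V} (hw : w ∈ kerPow Θ n) :
    br 𝕜 (FreeExt.zero 𝕜 g V x) w ∈ kerPow Θ n := by
  induction n generalizing w with
  | zero => exact br_zero_mem_kerModule Θ x hw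
  | succ n ih =>
    have : kerPow Θ (n + 1) ≤ (kerPow Θ (n + 1)).comap (br 𝕜 (FreeExt.zero 𝕜 g V x)) := by
      refine iSup_le fun v => ?_
      rintro _ ⟨w, hw, rfl⟩
      rw [Submodule.mem_comap, br_br w (FreeExt.zero_deg x) (FreeExt.pos_deg v), FreeExt.br_zero]
      exact add_mem (br_pos_mem_kerPow Θ _ hw)
        (units_smul_mem _ _ (br_pos_mem_kerPow Θ v (ih hw)))
    exact this hw

theorem br_hom_mem_kerPow (h2 : (2 : 𝕜) ≠ 0) {φ : V →ₗ[𝕜] g} (hφ : φ ∈ cyclic Θ) (n : ℕ)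
    {w : FreeExt 𝕜 g V} (hw : w ∈ kerPow Θ n) :
    br 𝕜 (FreeExt.hom 𝕜 g V φ) w ∈ ⨆ n, kerPow Θ n := by
  -- From $[\varphi,[v,w]]=[\varphi(v),w]-[v,[\varphi,w]]$, the map `φ` removes exactly one factor.
  -- For $w\in K$ the last term vanishes, which starts the induction.
  have key : ∀ n, kerPow Θ (n + 1) ≤ (kerPow Θ n).comap (br 𝕜 (FreeExt.hom 𝕜 g V φ)) := by
    intro n
    induction n with
    | zero =>
      refine iSup_le fun v => ?_
      rintro _ ⟨w, hw, rfl⟩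
      rw [Submodule.mem_comap, br_br w (FreeExt.hom_deg φ) (FreeExt.pos_deg v), FreeExt.br_hom,
        br_hom_kerModule Θ h2 hφ hw, map_zero, smul_zero, add_zero]
      exact br_zero_mem_kerPow Θ _ _ hw
    | succ n ih =>
      refine iSup_le fun v => ?_
      rintro _ ⟨w, hw, rfl⟩
      rw [Submodule.mem_comap, br_br w (FreeExt.hom_deg φ) (FreeExt.pos_deg v), FreeExt.br_hom]
      exact add_mem (br_zero_mem_kerPow Θ _ _ hw)
        (units_smul_mem _ _ (br_pos_mem_kerPow Θ v (ih hw)))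
  cases n with
  | zero =>
    rw [br_hom_kerModule Θ h2 hφ hw]
    exact zero_mem _
  | succ n => exact Submodule.mem_iSup_of_mem n (key n hw)

/-- Stabilizers are closed under brackets of homogeneous elements, so only the three kinds of
generators need checking: they lower, keep and raise the number of factors from `V`. -/
theorem TTilde_le_leftStabilizer (h2 : (2 : 𝕜) ≠ 0) :
    (TTilde Θ).toSubmodule ≤ leftStabilizer (⨆ n, kerPow Θ n) := by
  have of_le : ∀ x : FreeExt 𝕜 g V, (∀ n, ∀ w ∈ kerPow Θ n, br 𝕜 x w ∈ ⨆ n, kerPow Θ n) →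
      x ∈ leftStabilizer (⨆ n, kerPow Θ n) := fun x hx w hw =>
    (iSup_le hx : ⨆ n, kerPow Θ n ≤ (⨆ n, kerPow Θ n).comap (br 𝕜 x)) hw
  refine TTilde_le Θ _ ?_ ?_ ?_ fun i j x hx y hy => br_mem_leftStabilizer _ hx hy
  · exact fun φ hφ => of_le _ fun n w hw => br_hom_mem_kerPow Θ h2 hφ n hw
  · exact fun x => of_le _ fun n w hw =>
      Submodule.mem_iSup_of_mem n (br_zero_mem_kerPow Θ x n hw)
  · exact fun v => of_le _ fun n w hw =>
      Submodule.mem_iSup_of_mem (n + 1) (br_pos_mem_kerPow Θ v hw)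

/-- The ideal generated by `K` is concentrated in degrees at least `2`. -/
theorem proj_eq_zero_of_mem_kerIdeal (h2 : (2 : 𝕜) ≠ 0) {k : ℤ} (hk : k < 2)
    {a : (TTilde Θ).toSubmodule} (ha : a ∈ (kerIdeal Θ).toSubmodule) :
    proj 𝕜 (TTilde Θ).toSubmodule k a = 0 := by
  let I : GIdeal 𝕜 (TTilde Θ).toSubmodule :=
    GIdeal.ofLeft ((⨆ n, kerPow Θ n).comap (TTilde Θ).toSubmodule.subtype)
      (fun k x hx => by
        have : ⨆ n, kerPow Θ n ≤ (⨆ n, kerPow Θ n).comap (proj 𝕜 (FreeExt 𝕜 g V) k) :=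
          iSup_le fun n w hw => proj_mem_of_mem (kerPow_le_deg Θ n hw)
            (Submodule.mem_iSup_of_mem n hw) k
        rw [Submodule.mem_comap, Submodule.subtype_apply, GSubalgebra.coe_proj]
        exact this hx)
      (fun x y hy => TTilde_le_leftStabilizer Θ h2 x.2 _ hy)
  have h1 : a ∈ I.toSubmodule :=
    GIdeal.closure_le (I := I) (fun x hx => Submodule.mem_iSup_of_mem 0 hx) ha
  have h3 : ⨆ n, kerPow Θ n ≤ LinearMap.ker (proj 𝕜 (FreeExt 𝕜 g V) k) :=
    iSup_le fun n w hw => proj_ne (by omega) (kerPow_le_deg Θ n hw)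
  refine Subtype.ext ?_
  rw [GSubalgebra.coe_proj]
  exact h3 h1

variable {Θ} in
/-- An ideal intersecting the local part trivially is concentrated in positive degrees. -/
theorem GIdeal.eq_zero_of_mem_deg_neg (hV : Function.Injective (LieModule.toEnd 𝕜 g V))
    {J : GIdeal 𝕜 (TTilde Θ).toSubmodule}
    (hJ : J.toSubmodule ⊓ localPart 𝕜 (TTilde Θ).toSubmodule = ⊥) (n : ℕ)
    {a : (TTilde Θ).toSubmodule} (ha : a ∈ J.toSubmodule)
    (had : a ∈ deg 𝕜 (TTilde Θ).toSubmodule (-n)) : a = 0 := by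
  rw [GIdeal.inf_localPart_eq_bot_iff] at hJ
  have base : ∀ k : ℤ, -1 ≤ k → k ≤ 1 → ∀ a ∈ J.toSubmodule,
      a ∈ deg 𝕜 (TTilde Θ).toSubmodule k → a = 0 := fun k hk hk' a ha had => by
    rw [← proj_same had, hJ k hk hk' a ha]
  induction n generalizing a with
  | zero => exact base _ (by simp) (by simp) a ha had
  | succ n ih =>
    obtain ⟨y, hy⟩ := exists_neg_of_mem_deg ((TTilde Θ).mem_deg.1 had)
    refine Subtype.ext ?_
    -- The values of the map `y` are its brackets with `V`; these lie in `J`, in degree `-n`, and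
    -- vanish by induction.
    have : negSucc 𝕜 g V n y = 0 := by
      ext1 v
      refine FreeExt.neg_injective hV n ?_
      have hmem := J.br_mem_right ⟨_, pos_mem_TTilde Θ v⟩ a ha
      have hdeg := br_deg had
        ((TTilde Θ).mem_deg (x := ⟨_, pos_mem_TTilde Θ v⟩) |>.2 (FreeExt.pos_deg v))
      have h0 := ih hmem (by
        rwa [show (-((n + 1 : ℕ) : ℤ) + 1) = -n by push_cast; ring] at hdeg)
      have h1 := congrArg Subtype.val h0
      rw [GSubalgebra.coe_br, hy, FreeExt.br_succ_pos] at h1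
      rw [h1]
      simp
    rw [hy, (negSucc 𝕜 g V n).map_eq_zero_iff.1 this, map_zero]
    rfl

variable {Θ} in
/-- The degree `2` part of an ideal intersecting the local part trivially is included in `K`. -/
theorem GIdeal.mem_kerIdeal_of_mem_deg_two (h2 : (2 : 𝕜) ≠ 0)
    {J : GIdeal 𝕜 (TTilde Θ).toSubmodule}
    (hJ : J.toSubmodule ⊓ localPart 𝕜 (TTilde Θ).toSubmodule = ⊥)
    {a : (TTilde Θ).toSubmodule} (ha : a ∈ J.toSubmodule)
    (had : a ∈ deg 𝕜 (TTilde Θ).toSubmodule 2) : a ∈ (kerIdeal Θ).toSubmodule := by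
  rw [GIdeal.inf_localPart_eq_bot_iff] at hJ
  -- The degree $2$ part of `J` is one of the submodules whose sum is `K`: it is `g`-stable since
  -- `g` lies in `TTilde Θ`, and it lies in the kernel of the symmetric product.
  let W : Submodule 𝕜 (FreeExt 𝕜 g V) :=
    (J.toSubmodule ⊓ deg 𝕜 (TTilde Θ).toSubmodule 2).map (TTilde Θ).toSubmodule.subtype
  have hW : W ≤ kerModule Θ := by
    refine le_sSup ⟨?_, ?_⟩
    · rintro x _ ⟨w, ⟨hw, hw'⟩, rfl⟩
      refine ⟨br 𝕜 (⟨_, zero_mem_TTilde Θ x⟩ : (TTilde Θ).toSubmodule) w,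
        ⟨J.br_mem_left _ _ hw, ?_⟩, rfl⟩
      have := br_deg ((TTilde Θ).mem_deg (x := ⟨_, zero_mem_TTilde Θ x⟩) |>.2
        (FreeExt.zero_deg x)) hw'
      rwa [zero_add] at this
    · rintro _ ⟨w, ⟨hw, hw'⟩, rfl⟩
      obtain ⟨t, ht⟩ := exists_brTensor_of_mem_deg ((TTilde Θ).mem_deg.1 hw')
      rw [symKer_eq, Submodule.subtype_apply, ht]
      refine ⟨t, ?_, rfl⟩
      -- Bracketing with `Θ` lands in the degree $1$ part of `J`, which is zero. This bracket is
      -- twice the symmetric product of `t`.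
      have hmem := J.br_mem_left ⟨_, hom_mem_TTilde Θ (self_mem_cyclic Θ)⟩ w hw
      have hdeg := br_deg ((TTilde Θ).mem_deg (x := ⟨_, hom_mem_TTilde Θ (self_mem_cyclic Θ)⟩) |>.2
        (FreeExt.hom_deg Θ)) hw'
      rw [show (-1 + 2 : ℤ) = 1 by norm_num] at hdeg
      have h0 := hJ 1 (by norm_num) le_rfl _ hmem
      rw [proj_same hdeg] at h0
      have h1 := congrArg Subtype.val h0
      rw [GSubalgebra.coe_br, ht, br_hom_brTensor Θ h2] at h1
      have h3 : (2 : 𝕜) • TensorProduct.lift (symProd Θ) t = 0 :=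
        FreeExt.pos_injective (𝕜 := 𝕜) (g := g) (by rw [h1]; simp)
      exact (smul_eq_zero.1 h3).resolve_left h2
  exact GIdeal.subset_closure _ (hW ⟨a, ⟨ha, had⟩, rfl⟩)

variable {Θ} in
theorem GIdeal.proj_eq_zero_of_inf_localPart (hV : Function.Injective (LieModule.toEnd 𝕜 g V))
    {J : GIdeal 𝕜 (TTilde Θ).toSubmodule}
    (hJ : J.toSubmodule ⊓ localPart 𝕜 (TTilde Θ).toSubmodule = ⊥)
    {a : (TTilde Θ).toSubmodule} (ha : a ∈ J.toSubmodule) {k : ℤ} (hk : k < 2) :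
    proj 𝕜 (TTilde Θ).toSubmodule k a = 0 := by
  by_cases h : k = 1
  · exact J.inf_localPart_eq_bot_iff.1 hJ k (by omega) (by omega) a ha
  · obtain ⟨n, rfl⟩ : ∃ n : ℕ, k = -n := ⟨k.natAbs, by omega⟩
    exact GIdeal.eq_zero_of_mem_deg_neg hV hJ n (J.homogeneous _ a ha) (proj_mem _ a)

/-- The subspace spanned by the values of elements of the cyclic module generated by `Θ ≠ 0`. -/
theorem span_cyclic_apply (hg : LieAlgebra.IsSimple 𝕜 g) (hΘ : Θ ≠ 0) (x : g) :
    x ∈ Submodule.span 𝕜 {x | ∃ φ ∈ cyclic Θ, ∃ v, φ v = x} := by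
  -- The span is an ideal because $[x,\varphi(v)]=(x\cdot\varphi)(v)+\varphi(x\cdot v)$. It contains
  -- the values of `Θ`, so it is nonzero and by simplicity equals `g`.
  let I : LieIdeal 𝕜 g :=
    { Submodule.span 𝕜 {x | ∃ φ ∈ cyclic Θ, ∃ v, φ v = x} with
      lie_mem := fun {x y} hy => by
        change y ∈ Submodule.span 𝕜 _ at hy
        change ⁅x, y⁆ ∈ Submodule.span 𝕜 _
        induction hy using Submodule.span_induction with
        | mem y h =>
          obtain ⟨φ, hφ, v, rfl⟩ := h
          have : ⁅x, φ v⁆ = ⁅x, φ⁆ v + φ ⁅x, v⁆ := by simp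
          rw [this]
          exact add_mem (Submodule.subset_span ⟨_, (cyclic Θ).lie_mem hφ, v, rfl⟩)
            (Submodule.subset_span ⟨φ, hφ, _, rfl⟩)
        | zero => simp
        | add y z _ _ hy hz =>
          rw [lie_add]
          exact add_mem hy hz
        | smul c y _ hy =>
          rw [lie_smul]
          exact Submodule.smul_mem _ _ hy }
  obtain h | h := hg.eq_bot_or_eq_top I
  · refine absurd (LinearMap.ext fun v => ?_) hΘ
    have : Θ v ∈ I := Submodule.subset_span ⟨Θ, self_mem_cyclic Θ, v, rfl⟩
    rw [h] at this
    simpa using this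
  · have : x ∈ I := by
      rw [h]
      trivial
    exact this

end Triple

/-! ### The surjection from `TTilde Θ` to `PTilde` and the comparison of kernels. -/

section Main

variable {𝕜 : Type*} {g : Type*} {V : Type*} [Field 𝕜] [LieRing g] [LieAlgebra 𝕜 g]
  [AddCommGroup V] [Module 𝕜 V] [LieRingModule g V] [LieModule 𝕜 g V] (Θ : V →ₗ[𝕜] g)

attribute [local instance] LieRing.ofAssociativeRing

/-- The image of the cyclic module generated by `Θ` in `Hom(V, End V)`. -/
def cyclicImage : Submodule 𝕜 (V →ₗ[𝕜] Module.End 𝕜 V) :=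
  (cyclic Θ).toSubmodule.map
    (LinearMap.compRight 𝕜 (LieModule.toEnd 𝕜 g V : g →ₗ[𝕜] Module.End 𝕜 V))

theorem hom_mem_PTilde {φ : V →ₗ[𝕜] g} (hφ : φ ∈ cyclic Θ) :
    FreeExt.hom 𝕜 (Module.End 𝕜 V) V
      ((LieModule.toEnd 𝕜 g V : g →ₗ[𝕜] Module.End 𝕜 V) ∘ₗ φ) ∈
        (PTilde (cyclicImage Θ)).toSubmodule :=
  GSubalgebra.subset_closure _ (Or.inr ⟨_, ⟨φ, hφ, rfl⟩, rfl⟩)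

theorem pos_mem_PTilde (T : Submodule 𝕜 (V →ₗ[𝕜] Module.End 𝕜 V)) (v : V) :
    FreeExt.pos 𝕜 (Module.End 𝕜 V) V v ∈ (PTilde T).toSubmodule :=
  GSubalgebra.subset_closure _ (Or.inl ⟨v, rfl⟩)

/-- No generator of `PTilde` has degree $0$; the image of `g` is produced from the brackets
$[\rho\circ\varphi,v]=\rho(\varphi(v))$, whose arguments $\varphi(v)$ span `g`. -/
theorem zero_mem_PTilde (hg : LieAlgebra.IsSimple 𝕜 g) (hΘ : Θ ≠ 0) (x : g) :
    FreeExt.zero 𝕜 (Module.End 𝕜 V) V (LieModule.toEnd 𝕜 g V x) ∈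
      (PTilde (cyclicImage Θ)).toSubmodule := by
  have hx := span_cyclic_apply Θ hg hΘ x
  induction hx using Submodule.span_induction with
  | mem x h =>
    obtain ⟨φ, hφ, v, rfl⟩ := h
    have h := (PTilde (cyclicImage Θ)).br_mem _ (hom_mem_PTilde Θ hφ) _ (pos_mem_PTilde _ v)
    rwa [FreeExt.br_hom] at h
  | zero =>
    rw [map_zero, map_zero]
    exact zero_mem _
  | add x y _ _ hx hy =>
    rw [map_add, map_add]
    exact add_mem hx hy
  | smul c x _ hx =>
    rw [map_smul, map_smul]
    exact Submodule.smul_mem _ _ hx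

/-- The representation of `g` on `V` induces a surjective homomorphism which is injective in the
degrees of the local part. -/
theorem exists_TTilde_PTilde (hg : LieAlgebra.IsSimple 𝕜 g)
    (hV : Function.Injective (LieModule.toEnd 𝕜 g V)) (hΘ : Θ ≠ 0) :
    ∃ f : GLSHom 𝕜 (TTilde Θ).toSubmodule (PTilde (cyclicImage Θ)).toSubmodule,
      Function.Surjective f.toLinearMap ∧ ∀ k ≤ 1, ∀ a ∈ deg 𝕜 (TTilde Θ).toSubmodule k,
        f.toLinearMap a = 0 → a = 0 := by
  obtain ⟨F, hpos, hneg⟩ := FreeExt.exists_map (V := V) (LieModule.toEnd 𝕜 g V) fun x v => rfl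
  have hzero : ∀ x, F.toLinearMap (FreeExt.zero 𝕜 g V x) =
      FreeExt.zero 𝕜 (Module.End 𝕜 V) V (LieModule.toEnd 𝕜 g V x) := fun x => hneg 0 _
  have hhom : ∀ φ, F.toLinearMap (FreeExt.hom 𝕜 g V φ) = FreeExt.hom 𝕜 (Module.End 𝕜 V) V
      ((LieModule.toEnd 𝕜 g V : g →ₗ[𝕜] Module.End 𝕜 V) ∘ₗ φ) := fun φ => hneg 1 _
  have hle : ∀ x ∈ (TTilde Θ).toSubmodule,
      F.toLinearMap x ∈ (PTilde (cyclicImage Θ)).toSubmodule := by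
    refine TTilde_le Θ ((PTilde (cyclicImage Θ)).toSubmodule.comap F.toLinearMap) ?_ ?_ ?_ ?_
    · intro φ hφ
      rw [Submodule.mem_comap, hhom]
      exact hom_mem_PTilde Θ hφ
    · intro x
      rw [Submodule.mem_comap, hzero]
      exact zero_mem_PTilde Θ hg hΘ x
    · intro v
      rw [Submodule.mem_comap, hpos]
      exact pos_mem_PTilde _ v
    · intro i j x hx y hy _ _
      rw [Submodule.mem_comap, F.apply_br]
      exact (PTilde (cyclicImage Θ)).br_mem _ hx _ hy
  have hge : (PTilde (cyclicImage Θ)).toSubmodule ≤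
      (TTilde Θ).toSubmodule.map F.toLinearMap := by
    refine GSubalgebra.closure_le _ ?_ ?_ ?_
    · rintro _ (⟨v, rfl⟩ | ⟨φ, -, rfl⟩)
      · exact ⟨_, FreeExt.pos_deg v⟩
      · exact ⟨_, FreeExt.hom_deg φ⟩
    · rintro _ (⟨v, rfl⟩ | ⟨_, ⟨φ, hφ, rfl⟩, rfl⟩)
      · exact ⟨_, pos_mem_TTilde Θ v, hpos v⟩
      · exact ⟨_, hom_mem_TTilde Θ hφ, hhom φ⟩
    · rintro i j _ ⟨x, hx, rfl⟩ _ ⟨y, hy, rfl⟩ _ _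
      exact ⟨_, (TTilde Θ).br_mem x hx y hy, F.apply_br x y⟩
  -- In degree $1$ there is only `V`, on which the map is the identity. In degree $-n$ there are
  -- only multilinear maps into `g`, composed with the injective representation and then embedded,
  -- `V` being faithful over `End V`.
  have hinj : ∀ k ≤ 1, ∀ x ∈ deg 𝕜 (FreeExt 𝕜 g V) k, F.toLinearMap x = 0 → x = 0 := by
    intro k hk x hx h0
    obtain rfl | ⟨n, rfl⟩ : k = 1 ∨ ∃ n : ℕ, k = -n := by
      by_cases h : k = 1
      · exact Or.inl h
      · exact Or.inr ⟨k.natAbs, by omega⟩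
    · obtain ⟨v, rfl⟩ := exists_pos_of_mem_deg hx
      rw [hpos] at h0
      rw [(injective_iff_map_eq_zero _).1 FreeExt.pos_injective _ h0, map_zero]
    · obtain ⟨y, rfl⟩ := exists_neg_of_mem_deg hx
      rw [hneg] at h0
      have h1 := (injective_iff_map_eq_zero _).1
        (FreeExt.neg_injective (𝕜 := 𝕜) (g := Module.End 𝕜 V) (V := V)
          (fun x y h => LinearMap.ext fun v => congrArg (fun f => f v) h) n) _ h0
      rw [(injective_iff_map_eq_zero _).1 (negMap_injective hV n) _ h1, map_zero]
  refine ⟨{ F.toLinearMap.restrict hle with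
    map_deg := fun k x hx => F.apply_mem (x := (x : FreeExt 𝕜 g V)) hx
    map_br := fun x y => Subtype.ext (F.apply_br x y) }, ?_, ?_⟩
  · rintro ⟨y, hy⟩
    obtain ⟨x, hx, rfl⟩ := hge hy
    exact ⟨⟨x, hx⟩, rfl⟩
  · intro k hk a ha h0
    exact Subtype.ext (hinj k hk a ha (congrArg Subtype.val h0))

theorem nonempty_L_equiv_P (h2 : (2 : 𝕜) ≠ 0) (hg : LieAlgebra.IsSimple 𝕜 g)
    (hV : Function.Injective (LieModule.toEnd 𝕜 g V)) (hΘ : Θ ≠ 0) :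
    Nonempty (GLSEquiv 𝕜 (L Θ) (P (cyclicImage Θ))) := by
  obtain ⟨f, hf, hinj⟩ := exists_TTilde_PTilde Θ hg hV hΘ
  refine GLSEquiv.nonempty_of_ker_eq
    ((maxIdealGE 𝕜 (TAlg Θ) 3).toQuot.comp (kerIdeal Θ).toQuot)
    ((maxIdealLocal 𝕜 (PTilde (cyclicImage Θ)).toSubmodule).toQuot.comp f)
    ((GIdeal.toQuot_surjective _).comp (GIdeal.toQuot_surjective _))
    ((GIdeal.toQuot_surjective _).comp hf) fun a => ?_
  refine (GIdeal.toQuot_eq_zero _).trans (Iff.trans ?_ (GIdeal.toQuot_eq_zero _).symm)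
  constructor
  · intro ha
    -- `J` is the image under `f` of the kernel of the map to `L`. Below degree $3$ that kernel
    -- agrees with the ideal generated by `K`, which is zero in the local degrees.
    let J := ((maxIdealGE 𝕜 (TAlg Θ) 3).comap (kerIdeal Θ).toQuot).map f hf
    have hJ : J.toSubmodule ⊓ localPart 𝕜 (PTilde (cyclicImage Θ)).toSubmodule = ⊥ := by
      rw [GIdeal.inf_localPart_eq_bot_iff]
      rintro k hk hk' _ ⟨x, hx, rfl⟩
      have hx' : (kerIdeal Θ).toQuot.toLinearMap x ∈ degGE 𝕜 (TAlg Θ) 3 :=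
        GIdeal.sum_le (fun I hI => hI) hx
      have h0 := mem_degGE_iff.1 hx' k (by omega)
      rw [← GLSHom.map_proj, GIdeal.toQuot_eq_zero] at h0
      have h1 := proj_eq_zero_of_mem_kerIdeal Θ h2 (k := k) (by omega) h0
      rw [proj_same (proj_mem k x)] at h1
      rw [← f.map_proj, h1, map_zero]
    have hmem : f.toLinearMap a ∈ J.toSubmodule := Submodule.mem_map_of_mem ha
    exact GIdeal.le_sum hJ hmem
  · intro ha
    -- `J` is the kernel of the map to `P`; it misses the local part because `f` is injective there.
    let J := (maxIdealLocal 𝕜 (PTilde (cyclicImage Θ)).toSubmodule).comap f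
    have hJ : J.toSubmodule ⊓ localPart 𝕜 (TTilde Θ).toSubmodule = ⊥ := by
      rw [GIdeal.inf_localPart_eq_bot_iff]
      intro k hk hk' x hx
      refine hinj k hk' _ (proj_mem k x) ?_
      rw [f.map_proj]
      exact proj_eq_zero_of_mem_maxIdealLocal hk hk' hx
    -- Modulo `K` the ideal `J` starts in degree $3$: its degree $2$ part lies in the ideal
    -- generated by `K`, and its parts in lower degrees vanish.
    have hle : (J.map (kerIdeal Θ).toQuot (GIdeal.toQuot_surjective _)).toSubmodule ≤
        degGE 𝕜 (TAlg Θ) 3 := by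
      rintro _ ⟨x, hx, rfl⟩
      refine mem_degGE_iff.2 fun k hk => ?_
      rw [← GLSHom.map_proj, GIdeal.toQuot_eq_zero]
      by_cases h : k = 2
      · subst h
        exact GIdeal.mem_kerIdeal_of_mem_deg_two h2 hJ (J.homogeneous _ x hx) (proj_mem _ x)
      · rw [GIdeal.proj_eq_zero_of_inf_localPart hV hJ hx (by omega)]
        exact zero_mem _
    have hmem : (kerIdeal Θ).toQuot.toLinearMap a ∈
        (J.map (kerIdeal Θ).toQuot (GIdeal.toQuot_surjective _)).toSubmodule :=
      Submodule.mem_map_of_mem ha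
    exact GIdeal.le_sum hle hmem

end Main

end

end TensorHierarchy

theorem theorem4p9 {𝕜 : Type*} [RCLike 𝕜] {g : Type*} [LieRing g] [LieAlgebra 𝕜 g]
    {V : Type*} [AddCommGroup V] [Module 𝕜 V] [LieRingModule g V] [LieModule 𝕜 g V]
    (Θ : V →ₗ[𝕜] g) (hΘ : TensorHierarchy.IsLieLeibnizTriple Θ)
    (hg : LieAlgebra.IsSimple 𝕜 g) (hV : LieModule.IsFaithful 𝕜 g V) (hΘ0 : Θ ≠ 0) :
    ∃ T : Submodule 𝕜 (V →ₗ[𝕜] Module.End 𝕜 V),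
      Nonempty (TensorHierarchy.GLSEquiv 𝕜 (TensorHierarchy.L Θ) (TensorHierarchy.P T)) := by
  exact ⟨_, TensorHierarchy.nonempty_L_equiv_P Θ two_ne_zero hg hV.injective_toEnd hΘ0⟩
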